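/- Let $\alpha_0,\alpha_1,c_0\in\mathbb{R}$ be not all zero and let $$C(x,y,z)=\tfrac{\alpha_0}{2}(x^2+y^2)+\tfrac{\alpha_1}{4}(x^2+y^2)^2+\tfrac12 z^2-\tfrac12 c_0 ,\qquad \Sigma=C^{-1}(0)\subset\mathbb{R}^3 .$$ Assume that $\Sigma$ is non-empty and that every connected component of $\Sigma$ is non-compact. Let $\tilde\beta_1,\tilde\gamma_1,\tilde\delta_1\in\mathbb{R}$ satisfy $\tilde\beta_1+\tilde\gamma_1+\tilde\delta_1=\alpha_1$, and let $\hbar>0$ be small, in the sense that $1+2\hbar^2\tilde\delta_1>0$. Put $$a=-\frac{2\alpha_0\hbar^2}{1+2\hbar^2\tilde\delta_1},$$ and let $L(\vec x)=A\vec x+\vec u$ be an affine map of $\mathbb{R}^2$ with $$\det A=\frac{1+2\hbar^2\tilde\beta_1}{1+2\hbar^2\tilde\delta_1}=1,\qquad \operatorname{tr}A=\frac{2-2\hbar^2\tilde\gamma_1}{1+2\hbar^2\tilde\delta_1},\qquad \Delta=1+\det A-\operatorname{tr}A .$$ Let $\mathcal{C}_{L,a}$ be the unital associative complex $*$-algebra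 generated by $W$ and $V=W^*$ with the relations $$W^2V=aW-(\det A)VW^2+(\operatorname{tr}A)WVW,\qquad WV^2=aV-(\det A)V^2W+(\operatorname{tr}A)VWV .$$ With $D=WV$ and $\tilde D=VW$, the element $$\hat C=-4a(D+\tilde D)+(2-\operatorname{tr}A)(D+\tilde D)^2+(2+\operatorname{tr}A)(D-\tilde D)^2$$ is central. Below, "representation" means a $*$-representation $\phi$ of $\mathcal{C}_{L,a}$ by complex matrices with finitely many non-zero entries in each row and column, so that $\phi(x^*)=\phi(x)^\dagger$, acting on the finitely supported vectors, and such that $$\phi(\hat C)=4\hat c_1\mathbf{1},\qquad \hat c_1=\frac{4\hbar^2}{1+2\hbar^2\tilde\delta_1}\,c_0 .$$ It is irreducible if the space is non-zero and has no proper non-zero invariant subspace. An infinite-dimensional representation is one-sided if its basis is labelled by $\mathbb{N}$ and either $\phi(W)_{ij}\neq0\Leftrightarrow j=i+1$, or $\phi(W)_{ij}\neq0\Leftrightarrow i=j+1$. It is two-sided if its basis is labelled by $\mathbb{Z}$ and $\phi(W)_{ij}\ne0\Leftrightarrow j=i+1$. Two representations are equivalent if some linear isomorphism intertwines them. Then the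 following hold. 1. Every finite-dimensional irreducible representation is one-dimensional. 2. If $\Sigma$ has exactly two connected components, then there exist two inequivalent one-sided irreducible representations, and there is no two-sided representation. 3. Suppose that $\Sigma$ is connected and non-singular ($\nabla C\neq0$ at every point of $\Sigma$). Then there exists a two-sided irreducible representation. When $\alpha_1\neq0$, let $\mu=-\alpha_0/\alpha_1$ and $c=\mu^2+2c_0/\alpha_1$, and let $(\ast)$ be the condition $c\le\mu^2\left(1+\tfrac{|\Delta|}{4}\right)$. When $\alpha_1=0$, let $(\ast)$ be the condition $a^2+4\hat c_1\ge0$ (which is what the former condition amounts to for $\alpha_1<0$, once the denominators are cleared). If $a\le0$, or if $a>0$ and $(\ast)$ fails, then there is no one-sided representation. If $a>0$ and $(\ast)$ holds, then one-sided irreducible representations exist. -/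

import Mathlib

noncomputable section

namespace NCSurface

/-! ### The algebra attached to an affine map of the plane -/

/-- The two letters `W`, `V`. -/
inductive Gen
  | W
  | V

/-- The exchange `W ↔ V` of the two letters. -/
def Gen.swap : Gen → Gen
  | .W => .V
  | .V => .W

/-- Affine maps `L : ℝ² → ℝ²`. -/
abbrev AffPlane := (Fin 2 → ℝ) →ᵃ[ℝ] (Fin 2 → ℝ)

/-- `det A`, where `A` is the linear part of `L`. -/
def detA (L : AffPlane) : ℝ := LinearMap.det L.linear

/-- `tr A`, where `A` is the linear part of `L`. -/
def trA (L : AffPlane) : ℝ := LinearMap.trace ℝ (Fin 2 → ℝ) L.linear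

/-- The letters as elements of the free algebra `ℂ⟨W, V⟩`. -/
abbrev letter (g : Gen) : FreeAlgebra ℂ Gen := FreeAlgebra.ι ℂ g

/-- The defining relations
`W²V = aW - (det A) VW² + (tr A) WVW` and `WV² = aV - (det A) V²W + (tr A) VWV`. -/
inductive Rel (L : AffPlane) (a : ℝ) : FreeAlgebra ℂ Gen → FreeAlgebra ℂ Gen → Prop
  | left : Rel L a
      (letter .W * letter .W * letter .V)
      ((a : ℂ) • letter .W
        - ((detA L : ℝ) : ℂ) • (letter .V * letter .W * letter .W)
        + ((trA L : ℝ) : ℂ) • (letter .W * letter .V * letter .W))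
  | right : Rel L a
      (letter .W * letter .V * letter .V)
      ((a : ℂ) • letter .V
        - ((detA L : ℝ) : ℂ) • (letter .V * letter .V * letter .W)
        + ((trA L : ℝ) : ℂ) • (letter .V * letter .W * letter .V))

/-- The complex algebra `C_{L,a}`: the quotient of `ℂ⟨W, V⟩` by the two-sided ideal generated by
the defining relations. -/
def CAlg (L : AffPlane) (a : ℝ) : Type := RingQuot (Rel L a)

instance (L : AffPlane) (a : ℝ) : Ring (CAlg L a) := inferInstanceAs (Ring (RingQuot (Rel L a)))

instance (L : AffPlane) (a : ℝ) : Algebra ℂ (CAlg L a) :=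
  inferInstanceAs (Algebra ℂ (RingQuot (Rel L a)))

/-- The quotient map `ℂ⟨W, V⟩ → C_{L,a}`. -/
def CAlg.mk (L : AffPlane) (a : ℝ) : FreeAlgebra ℂ Gen →ₐ[ℂ] CAlg L a :=
  RingQuot.mkAlgHom ℂ (Rel L a)

/-- The classes of `W` and `V` in `C_{L,a}`. -/
def CAlg.gen (L : AffPlane) (a : ℝ) (g : Gen) : CAlg L a := CAlg.mk L a (letter g)

theorem CAlg.rel_left (L : AffPlane) (a : ℝ) :
    CAlg.gen L a .W * CAlg.gen L a .W * CAlg.gen L a .V =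
      (a : ℂ) • CAlg.gen L a .W
        - ((detA L : ℝ) : ℂ) • (CAlg.gen L a .V * CAlg.gen L a .W * CAlg.gen L a .W)
        + ((trA L : ℝ) : ℂ) • (CAlg.gen L a .W * CAlg.gen L a .V * CAlg.gen L a .W) := by
  have h : CAlg.mk L a _ = CAlg.mk L a _ := RingQuot.mkAlgHom_rel ℂ (Rel.left (L := L) (a := a))
  simp only [map_mul, map_add, map_sub, map_smul] at h
  exact h

theorem CAlg.rel_right (L : AffPlane) (a : ℝ) :
    CAlg.gen L a .W * CAlg.gen L a .V * CAlg.gen L a .V =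
      (a : ℂ) • CAlg.gen L a .V
        - ((detA L : ℝ) : ℂ) • (CAlg.gen L a .V * CAlg.gen L a .V * CAlg.gen L a .W)
        + ((trA L : ℝ) : ℂ) • (CAlg.gen L a .V * CAlg.gen L a .W * CAlg.gen L a .V) := by
  have h : CAlg.mk L a _ = CAlg.mk L a _ := RingQuot.mkAlgHom_rel ℂ (Rel.right (L := L) (a := a))
  simp only [map_mul, map_add, map_sub, map_smul] at h
  exact h

/-- Two algebra homomorphisms out of `C_{L,a}` that agree on `W` and `V` are equal. -/
theorem CAlg.hom_ext {L : AffPlane} {a : ℝ} {B : Type*} [Semiring B] [Algebra ℂ B]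
    {f g : CAlg L a →ₐ[ℂ] B} (h : ∀ x, f (CAlg.gen L a x) = g (CAlg.gen L a x)) : f = g := by
  have key : f.comp (CAlg.mk L a) = g.comp (CAlg.mk L a) := by
    apply FreeAlgebra.hom_ext
    funext x
    exact h x
  exact RingQuot.ringQuot_ext' ℂ f g key

/-- The opposite of a complex algebra, with complex scalars acting through conjugation. Linear
homomorphisms into it are conjugate-linear anti-homomorphisms. -/
def ConjOp (B : Type*) : Type _ := Bᵐᵒᵖ

instance (B : Type*) [Ring B] : Ring (ConjOp B) := inferInstanceAs (Ring Bᵐᵒᵖ)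

instance (B : Type*) [Ring B] [Algebra ℂ B] : Algebra ℂ (ConjOp B) :=
  RingHom.toAlgebra' ((algebraMap ℂ Bᵐᵒᵖ).comp (starRingEnd ℂ) : ℂ →+* Bᵐᵒᵖ)
    (fun c x => Algebra.commutes (A := Bᵐᵒᵖ) (starRingEnd ℂ c) x)

/-- The canonical map `B → ConjOp B`. -/
def ConjOp.of {B : Type*} (x : B) : ConjOp B := MulOpposite.op x

/-- The canonical map `ConjOp B → B`. -/
def ConjOp.un {B : Type*} (x : ConjOp B) : B := MulOpposite.unop x

theorem ConjOp.un_of {B : Type*} (x : B) : ConjOp.un (ConjOp.of x) = x := rfl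
theorem ConjOp.un_inj {B : Type*} {x y : ConjOp B} (h : x.un = y.un) : x = y :=
  MulOpposite.unop_injective h
theorem ConjOp.un_mul {B : Type*} [Ring B] (x y : ConjOp B) : (x * y).un = y.un * x.un := rfl
theorem ConjOp.un_add {B : Type*} [Ring B] (x y : ConjOp B) : (x + y).un = x.un + y.un := rfl
theorem ConjOp.un_sub {B : Type*} [Ring B] (x y : ConjOp B) : (x - y).un = x.un - y.un := rfl
theorem ConjOp.un_zero {B : Type*} [Ring B] : (0 : ConjOp B).un = 0 := rfl
theorem ConjOp.un_one {B : Type*} [Ring B] : (1 : ConjOp B).un = 1 := rfl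
theorem ConjOp.un_algebraMap {B : Type*} [Ring B] [Algebra ℂ B] (c : ℂ) :
    (algebraMap ℂ (ConjOp B) c).un = algebraMap ℂ B (starRingEnd ℂ c) := rfl
theorem ConjOp.un_smul {B : Type*} [Ring B] [Algebra ℂ B] (c : ℂ) (x : ConjOp B) :
    (c • x).un = (starRingEnd ℂ c) • x.un := by
  rw [Algebra.smul_def, ConjOp.un_mul, ConjOp.un_algebraMap, Algebra.smul_def, Algebra.commutes]

/-- The conjugate-linear anti-homomorphism of `C_{L,a}` with `W ↦ V`, `V ↦ W`. -/
def CAlg.starHom (L : AffPlane) (a : ℝ) : CAlg L a →ₐ[ℂ] ConjOp (CAlg L a) :=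
  RingQuot.liftAlgHom ℂ
    ⟨FreeAlgebra.lift ℂ (fun g : Gen => ConjOp.of (CAlg.gen L a g.swap)), by
      intro x y h
      apply ConjOp.un_inj
      cases h
      · simpa only [map_mul, map_add, map_sub, map_smul, FreeAlgebra.lift_ι_apply, ConjOp.un_mul,
          ConjOp.un_add, ConjOp.un_sub, ConjOp.un_smul, ConjOp.un_of, Gen.swap, Complex.conj_ofReal,
          mul_assoc] using CAlg.rel_right L a
      · simpa only [map_mul, map_add, map_sub, map_smul, FreeAlgebra.lift_ι_apply, ConjOp.un_mul,
          ConjOp.un_add, ConjOp.un_sub, ConjOp.un_smul, ConjOp.un_of, Gen.swap, Complex.conj_ofReal,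
          mul_assoc] using CAlg.rel_left L a⟩

theorem CAlg.starHom_gen (L : AffPlane) (a : ℝ) (g : Gen) :
    (CAlg.starHom L a (CAlg.gen L a g)).un = CAlg.gen L a g.swap := by
  have h : CAlg.starHom L a (CAlg.gen L a g) = ConjOp.of (CAlg.gen L a g.swap) := by
    unfold CAlg.starHom CAlg.gen CAlg.mk
    erw [RingQuot.liftAlgHom_mkAlgHom_apply]
    simp only [FreeAlgebra.lift_ι_apply]
  rw [h, ConjOp.un_of]

theorem CAlg.starHom_starHom (L : AffPlane) (a : ℝ) (x : CAlg L a) :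
    (CAlg.starHom L a (CAlg.starHom L a x).un).un = x := by
  let F : CAlg L a →ₐ[ℂ] CAlg L a :=
    { toFun := fun x => (CAlg.starHom L a (CAlg.starHom L a x).un).un
      map_one' := by simp only [map_one, ConjOp.un_one]
      map_mul' := fun x y => by simp only [map_mul, ConjOp.un_mul]
      map_zero' := by simp only [map_zero, ConjOp.un_zero]
      map_add' := fun x y => by simp only [map_add, ConjOp.un_add]
      commutes' := fun c => by
        simp only [AlgHom.commutes, ConjOp.un_algebraMap, Complex.conj_conj] }
  have hF : F = AlgHom.id ℂ _ := by
    apply CAlg.hom_ext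
    intro g
    change (CAlg.starHom L a (CAlg.starHom L a (CAlg.gen L a g)).un).un = CAlg.gen L a g
    rw [CAlg.starHom_gen, CAlg.starHom_gen]
    cases g <;> rfl
  exact DFunLike.congr_fun hF x

/-- `C_{L,a}` is a `*`-algebra, with `W* = V` and `V* = W`. -/
instance (L : AffPlane) (a : ℝ) : StarRing (CAlg L a) where
  star x := (CAlg.starHom L a x).un
  star_involutive := CAlg.starHom_starHom L a
  star_mul x y := by
    change (CAlg.starHom L a (x * y)).un = _
    rw [map_mul, ConjOp.un_mul]
  star_add x y := by
    change (CAlg.starHom L a (x + y)).un = _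
    rw [map_add, ConjOp.un_add]

instance (L : AffPlane) (a : ℝ) : StarModule ℂ (CAlg L a) where
  star_smul c x := by
    change (CAlg.starHom L a (c • x)).un = _
    rw [map_smul, ConjOp.un_smul]
    rfl

theorem CAlg.star_gen (L : AffPlane) (a : ℝ) (g : Gen) :
    star (CAlg.gen L a g) = CAlg.gen L a g.swap :=
  CAlg.starHom_gen L a g

/-- The element `Ĉ = -4a(D + D̃) + (2 - tr A)(D + D̃)² + (2 + tr A)(D - D̃)²` of `C_{L,a}`, where
`D = WV` and `D̃ = VW`. It is central when `det A = 1`. -/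
def casimir (L : AffPlane) (a : ℝ) : CAlg L a :=
  let D := CAlg.gen L a .W * CAlg.gen L a .V
  let D' := CAlg.gen L a .V * CAlg.gen L a .W
  ((-4 * a : ℝ) : ℂ) • (D + D') + ((2 - trA L : ℝ) : ℂ) • (D + D') ^ 2
    + ((2 + trA L : ℝ) : ℂ) • (D - D') ^ 2

/-! ### Representations by matrices -/

/-- The `(i, j)` entry of the matrix of an operator on the space `ι →₀ ℂ` with its standard
orthonormal basis. -/
def entry {ι : Type*} (T : Module.End ℂ (ι →₀ ℂ)) (i j : ι) : ℂ := T (Finsupp.single j 1) i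

/-- A `*`-representation of `C_{L,a}` by complex matrices with index set `ι`, acting on the finitely
supported vectors. The condition `φ(x*) = φ(x)†` forces the rows of every matrix `φ(x)`, as well as
its columns, to have finitely many non-zero entries. For `ι = Fin n` these are the `n`-dimensional
`*`-representations. -/
structure StarRep (L : AffPlane) (a : ℝ) (ι : Type*) where
  /-- the underlying representation -/
  hom : CAlg L a →ₐ[ℂ] Module.End ℂ (ι →₀ ℂ)
  /-- the matrix of `φ(x*)` is the conjugate transpose of the matrix of `φ(x)` -/
  map_star : ∀ x i j, entry (hom (star x)) i j = star (entry (hom x) j i)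

namespace StarRep

variable {L : AffPlane} {a : ℝ} {ι κ : Type*}

/-- `φ` is irreducible: the space is non-zero and has no proper non-zero invariant subspace. -/
def IsIrreducible (φ : StarRep L a ι) : Prop :=
  Nonempty ι ∧ ∀ S : Submodule ℂ (ι →₀ ℂ),
    (∀ x, ∀ v ∈ S, φ.hom x v ∈ S) → S = ⊥ ∨ S = ⊤

/-- `φ` and `ψ` are equivalent: some linear isomorphism, unitary or not, intertwines them. -/
def Equivalent (φ : StarRep L a ι) (ψ : StarRep L a κ) : Prop :=
  ∃ U : (ι →₀ ℂ) ≃ₗ[ℂ] (κ →₀ ℂ), ∀ x v, U (φ.hom x v) = ψ.hom x (U v)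

/-- The matrix entry `φ(W)_{ij}`; the directed graph of `φ(W)` has an edge from `i` to `j` exactly
when it is non-zero. -/
def W (φ : StarRep L a ι) (i j : ι) : ℂ := entry (φ.hom (CAlg.gen L a .W)) i j

/-- A representation on a basis labelled by the natural numbers is one-sided if the directed graph
of `φ(W)` is an infinite path with one end, that is, `0 → 1 → 2 → ⋯` or `⋯ → 2 → 1 → 0`. -/
def IsOneSided (φ : StarRep L a ℕ) : Prop :=
  (∀ i j, φ.W i j ≠ 0 ↔ j = i + 1) ∨ (∀ i j, φ.W i j ≠ 0 ↔ i = j + 1)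

/-- A representation on a basis labelled by the integers is two-sided if the directed graph of
`φ(W)` is the two-sided infinite path `⋯ → -1 → 0 → 1 → ⋯`. -/
def IsTwoSided (φ : StarRep L a ℤ) : Prop :=
  ∀ i j, φ.W i j ≠ 0 ↔ j = i + 1

/-- `φ(Ĉ) = 4ĉ₁ · 1`. -/
def HasCasimir (φ : StarRep L a ι) (chat₁ : ℝ) : Prop :=
  φ.hom (casimir L a) = ((4 * chat₁ : ℝ) : ℂ) • (1 : Module.End ℂ (ι →₀ ℂ))

end StarRep

/-! ### The surface -/

/-- The polynomial `C(x,y,z) = (α₀/2)(x²+y²) + (α₁/4)(x²+y²)² + z²/2 - c₀/2`. -/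
def poly (α₀ α₁ c₀ : ℝ) (p : ℝ × ℝ × ℝ) : ℝ :=
  α₀ / 2 * (p.1 ^ 2 + p.2.1 ^ 2) + α₁ / 4 * (p.1 ^ 2 + p.2.1 ^ 2) ^ 2
    + 1 / 2 * p.2.2 ^ 2 - 1 / 2 * c₀

/-- `Σ = C⁻¹(0)`. -/
def surface (α₀ α₁ c₀ : ℝ) : Set (ℝ × ℝ × ℝ) := {p | poly α₀ α₁ c₀ p = 0}

/-- `Σ` is non-singular: the differential of `C` vanishes at no point of `Σ`. -/
def Nonsingular (α₀ α₁ c₀ : ℝ) : Prop :=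
  ∀ p ∈ surface α₀ α₁ c₀, fderiv ℝ (poly α₀ α₁ c₀) p ≠ 0

end NCSurface

end

noncomputable section

namespace NCSurface

section

variable {L : AffPlane} {a : ℝ} {ι : Type*}

/-! ### Presentation of the algebra -/

/-! Write `t = tr A`. A joint eigenvector of `WV` and `VW` has a pair of weights `(p, q)`. Since
`det A = 1`, the relations send it under `W` to `(q, a + t q - p)` and under `V` to `(a + t p - q,
p)`, as long as the images are non-zero. So weights run along sequences with `e (n+1) = a + t e n -
e (n-1)`, and adjointness of `V` and `W` makes them non-negative. The central element fixes a
conserved quantity, which turns into `(e (n+1) - e n) * (e n - e (n-1)) = G (e n)`, where `G r = ĉ₁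
+ 2 a r + (t - 2) r²`.

The surface is `z² = profile (x² + y²)`, and `G` is a positive multiple of `profile`. If no
component is compact, the set of `r ≥ 0` with `profile r ≥ 0` is closed upwards
(`profile_nonneg_of_le`); in particular `α₁ ≤ 0`, that is, `t ≥ 2`.

Finite dimension: at the largest weight of `WV` the two neighbouring weights are no larger, so `G ≤
0` there; the shape of `G` then forces both neighbours to equal it, and `W` and `V` acquire a common
eigenvector (`dim_eq_one`).

Two components: `profile > 0` on the half-line. The sequence from `0` to the positive root of `d² -
a d = ĉ₁` increases forever and gives a lowering and a raising weighted shift (`exists_oneSided`). A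
two-sided sequence would be strictly monotone with steps bounded below on one side, and would become
negative (`no_positive_seq`).

Connected and non-singular: `profile` has a positive simple root `r` (`exists_throat`). The sequence
that is symmetric about two consecutive values `r` gives a two-sided shift (`exists_twoSided`). The
end vector of a one-sided shift requires a positive root of `d² - a d = ĉ₁`; as `ĉ₁ < 0`, it exists
exactly when `a > 0` and `a² + 4 ĉ₁ ≥ 0`. -/

theorem CAlg.induction {P : CAlg L a → Prop} (halg : ∀ c : ℂ, P (algebraMap ℂ _ c))
    (hgen : ∀ g, P (CAlg.gen L a g)) (hmul : ∀ x y, P x → P y → P (x * y))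
    (hadd : ∀ x y, P x → P y → P (x + y)) (x : CAlg L a) : P x := by
  obtain ⟨y, rfl⟩ : ∃ y, CAlg.mk L a y = x := RingQuot.mkAlgHom_surjective ℂ (Rel L a) x
  induction y using FreeAlgebra.induction with
  | grade0 c => rw [AlgHom.commutes]; exact halg c
  | grade1 g => exact hgen g
  | mul x y hx hy => rw [map_mul]; exact hmul _ _ hx hy
  | add x y hx hy => rw [map_add]; exact hadd _ _ hx hy

/-- The homomorphism out of `C_{L,a}` determined by two elements satisfying the relations. -/
def CAlg.lift {B : Type*} [Ring B] [Algebra ℂ B] (F : Gen → B)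
    (hl : F .W * F .W * F .V = (a : ℂ) • F .W - ((detA L : ℝ) : ℂ) • (F .V * F .W * F .W)
      + ((trA L : ℝ) : ℂ) • (F .W * F .V * F .W))
    (hr : F .W * F .V * F .V = (a : ℂ) • F .V - ((detA L : ℝ) : ℂ) • (F .V * F .V * F .W)
      + ((trA L : ℝ) : ℂ) • (F .V * F .W * F .V)) : CAlg L a →ₐ[ℂ] B :=
  RingQuot.liftAlgHom ℂ ⟨FreeAlgebra.lift ℂ F, by
    intro x y h
    cases h
    · simpa only [map_mul, map_add, map_sub, map_smul, FreeAlgebra.lift_ι_apply] using hl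
    · simpa only [map_mul, map_add, map_sub, map_smul, FreeAlgebra.lift_ι_apply] using hr⟩

theorem CAlg.lift_gen {B : Type*} [Ring B] [Algebra ℂ B] (F : Gen → B)
    (hl : F .W * F .W * F .V = (a : ℂ) • F .W - ((detA L : ℝ) : ℂ) • (F .V * F .W * F .W)
      + ((trA L : ℝ) : ℂ) • (F .W * F .V * F .W))
    (hr : F .W * F .V * F .V = (a : ℂ) • F .V - ((detA L : ℝ) : ℂ) • (F .V * F .V * F .W)
      + ((trA L : ℝ) : ℂ) • (F .V * F .W * F .V)) (g : Gen) :
    CAlg.lift F hl hr (CAlg.gen L a g) = F g := by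
  unfold CAlg.lift CAlg.gen CAlg.mk
  erw [RingQuot.liftAlgHom_mkAlgHom_apply]
  exact FreeAlgebra.lift_ι_apply _ _

/-! ### Adjoint pairs of matrices -/

/-- The matrix of `S` is the conjugate transpose of the matrix of `T`. -/
def IsAdj (S T : Module.End ℂ (ι →₀ ℂ)) : Prop := ∀ i j, entry S i j = star (entry T j i)

theorem apply_eq_sum (T : Module.End ℂ (ι →₀ ℂ)) (v : ι →₀ ℂ) (i : ι) {s : Finset ι}
    (hs : v.support ⊆ s) : T v i = ∑ j ∈ s, entry T i j * v j := by
  have h : v = ∑ j ∈ s, v j • Finsupp.single j 1 := by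
    conv_lhs => rw [← Finsupp.sum_single v]
    rw [Finsupp.sum_of_support_subset _ hs _ (by simp)]
    simp
  conv_lhs => rw [h]
  simp only [map_sum, map_smul, Finsupp.coe_finsetSum, Finset.sum_apply, Finsupp.coe_smul,
    Pi.smul_apply, smul_eq_mul, entry]
  exact Finset.sum_congr rfl fun j _ => mul_comm _ _

theorem entry_mul (S T : Module.End ℂ (ι →₀ ℂ)) (i k : ι) {s : Finset ι}
    (hs : (T (Finsupp.single k 1)).support ⊆ s) :
    entry (S * T) i k = ∑ j ∈ s, entry S i j * entry T j k :=
  apply_eq_sum S _ i hs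

/-- Matrix products are sums over the finite support of a column; summing over the union of the two
relevant supports makes the two sides comparable term by term. -/
theorem IsAdj.mul {S T S' T' : Module.End ℂ (ι →₀ ℂ)} (h : IsAdj S T) (h' : IsAdj S' T') :
    IsAdj (S' * S) (T * T') := by
  classical
  intro i k
  rw [entry_mul S' S i k Finset.subset_union_left,
    entry_mul T T' k i (Finset.subset_union_right (s₁ := (S (Finsupp.single k 1)).support)),
    star_sum]
  refine Finset.sum_congr rfl fun j _ => ?_
  rw [star_mul', h, h', mul_comm]

/-- A representation is a `*`-representation as soon as the images of `W` and `V` are adjoint. -/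
def StarRep.ofAdj (φ : CAlg L a →ₐ[ℂ] Module.End ℂ (ι →₀ ℂ))
    (h : IsAdj (φ (CAlg.gen L a .V)) (φ (CAlg.gen L a .W))) : StarRep L a ι where
  hom := φ
  map_star x := by
    change IsAdj (φ (star x)) (φ x)
    induction x using CAlg.induction with
    | halg c =>
      intro i j
      classical
      rw [← algebraMap_star_comm, AlgHom.commutes, AlgHom.commutes]
      simp only [entry, Module.algebraMap_end_apply, Finsupp.coe_smul, Pi.smul_apply,
        smul_eq_mul, star_mul', Finsupp.single_apply]
      by_cases hij : i = j
      · simp [hij]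
      · simp [hij, Ne.symm hij]
    | hgen g =>
      rw [CAlg.star_gen]
      cases g
      · exact h
      · intro i j
        rw [Gen.swap, h j i, star_star]
    | hmul x y hx hy =>
      rw [star_mul, map_mul, map_mul]
      exact hx.mul hy
    | hadd x y hx hy =>
      intro i j
      rw [star_add, map_add, map_add]
      have h1 := hx i j
      have h2 := hy i j
      simp only [entry] at h1 h2 ⊢
      simp [h1, h2]

/-! ### Joint weights of `WV` and `VW` -/

namespace StarRep

variable (φ : StarRep L a ι)

/-- The operator `φ(W)`. -/
def opW : Module.End ℂ (ι →₀ ℂ) := φ.hom (CAlg.gen L a .W)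

/-- The operator `φ(V)`. -/
def opV : Module.End ℂ (ι →₀ ℂ) := φ.hom (CAlg.gen L a .V)

theorem isAdj_VW : IsAdj φ.opV φ.opW := fun i j => by
  have := φ.map_star (CAlg.gen L a .W) i j
  rwa [CAlg.star_gen] at this

theorem isAdj_WV : IsAdj φ.opW φ.opV := fun i j => by rw [φ.isAdj_VW j i, star_star]

theorem W_eq (i j : ι) : φ.W i j = entry φ.opW i j := rfl

theorem rel_left (hdet : detA L = 1) (v : ι →₀ ℂ) :
    φ.opW (φ.opW (φ.opV v)) = (a : ℂ) • φ.opW v - φ.opV (φ.opW (φ.opW v))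
      + ((trA L : ℝ) : ℂ) • φ.opW (φ.opV (φ.opW v)) := by
  have h := congrArg (fun x => φ.hom x v) (CAlg.rel_left L a)
  simpa only [hdet, opW, opV, map_add, map_sub, map_smul, map_mul, LinearMap.add_apply,
    LinearMap.sub_apply, LinearMap.smul_apply, Module.End.mul_apply, Complex.ofReal_one,
    one_smul] using h

theorem rel_right (hdet : detA L = 1) (v : ι →₀ ℂ) :
    φ.opW (φ.opV (φ.opV v)) = (a : ℂ) • φ.opV v - φ.opV (φ.opV (φ.opW v))
      + ((trA L : ℝ) : ℂ) • φ.opV (φ.opW (φ.opV v)) := by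
  have h := congrArg (fun x => φ.hom x v) (CAlg.rel_right L a)
  simpa only [hdet, opW, opV, map_add, map_sub, map_smul, map_mul, LinearMap.add_apply,
    LinearMap.sub_apply, LinearMap.smul_apply, Module.End.mul_apply, Complex.ofReal_one,
    one_smul] using h

theorem isIrreducible_iff : φ.IsIrreducible ↔ Nonempty ι ∧ ∀ S : Submodule ℂ (ι →₀ ℂ),
    (∀ v ∈ S, φ.opW v ∈ S) → (∀ v ∈ S, φ.opV v ∈ S) → S = ⊥ ∨ S = ⊤ := by
  refine and_congr_right fun _ => forall_congr' fun S =>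
    ⟨fun h hW hV => h fun x => ?_, fun h hx => h (hx _) (hx _)⟩
  induction x using CAlg.induction with
  | halg c =>
    intro v hv
    rw [AlgHom.commutes, Module.algebraMap_end_apply]
    exact S.smul_mem c hv
  | hgen g => cases g <;> assumption
  | hmul x y hx hy => intro v hv; rw [map_mul]; exact hx _ (hy v hv)
  | hadd x y hx hy => intro v hv; rw [map_add]; exact S.add_mem (hx v hv) (hy v hv)

theorem casimir_apply {v : ι →₀ ℂ} {p q : ℂ} (hp : φ.opW (φ.opV v) = p • v)
    (hq : φ.opV (φ.opW v) = q • v) :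
    φ.hom (casimir L a) v = (4 * (p ^ 2 + q ^ 2 - (trA L : ℝ) * p * q - a * (p + q))) • v := by
  have h : ∀ x, φ.hom (CAlg.gen L a x) = match x with | .W => φ.opW | .V => φ.opV := by
    rintro (_ | _) <;> rfl
  simp only [casimir, map_add, map_smul, map_mul, map_sub, h, LinearMap.add_apply,
    LinearMap.smul_apply, Module.End.mul_apply, LinearMap.sub_apply, pow_two, hp, hq]
  simp only [← sub_smul, ← add_smul, smul_smul]
  push_cast
  congr 1
  ring

/-- On a joint eigenvector of `φ(WV)` and `φ(VW)`, the value of `Ĉ` is a polynomial in the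
eigenvalues. -/
theorem HasCasimir.eq {φ : StarRep L a ι} {chat : ℝ} (h : φ.HasCasimir chat) {v : ι →₀ ℂ}
    (hv : v ≠ 0) {p q : ℝ} (hp : φ.opW (φ.opV v) = (p : ℂ) • v)
    (hq : φ.opV (φ.opW v) = (q : ℂ) • v) :
    p ^ 2 + q ^ 2 - trA L * p * q - a * (p + q) = chat := by
  have h1 := φ.casimir_apply hp hq
  rw [h, LinearMap.smul_apply, Module.End.one_apply] at h1
  have h2 := smul_left_injective ℂ hv h1
  norm_cast at h2
  linarith

theorem weight_W {φ : StarRep L a ι} (hdet : detA L = 1) {v : ι →₀ ℂ} {p q : ℂ}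
    (hp : φ.opW (φ.opV v) = p • v) (hq : φ.opV (φ.opW v) = q • v) :
    φ.opV (φ.opW (φ.opW v)) = (a + (trA L : ℝ) * q - p) • φ.opW v := by
  have h := φ.rel_left hdet v
  rw [hp, hq, map_smul, map_smul] at h
  have : φ.opV (φ.opW (φ.opW v))
      = (a : ℂ) • φ.opW v + ((trA L : ℝ) : ℂ) • q • φ.opW v - p • φ.opW v := by
    rw [h]; abel
  rw [this]
  module

theorem weight_V {φ : StarRep L a ι} (hdet : detA L = 1) {v : ι →₀ ℂ} {p q : ℂ}
    (hp : φ.opW (φ.opV v) = p • v) (hq : φ.opV (φ.opW v) = q • v) :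
    φ.opW (φ.opV (φ.opV v)) = (a + (trA L : ℝ) * p - q) • φ.opV v := by
  have h := φ.rel_right hdet v
  rw [hp, hq, map_smul, map_smul] at h
  rw [h]
  module

end StarRep

end

section

variable {L : AffPlane} {a : ℝ} {n : ℕ}

/-! ### Finite-dimensional representations -/

theorem exists_eigenvector_mem {E : Type*} [AddCommGroup E] [Module ℂ E] [FiniteDimensional ℂ E]
    (T : Module.End ℂ E) (S : Submodule ℂ E) (hT : ∀ v ∈ S, T v ∈ S) {v : E} (hv : v ∈ S)
    (hv0 : v ≠ 0) : ∃ w ∈ S, w ≠ 0 ∧ ∃ μ : ℂ, T w = μ • w := by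
  have : Nontrivial S := ⟨⟨⟨v, hv⟩, 0, fun h => hv0 (congrArg Subtype.val h)⟩⟩
  obtain ⟨μ, hμ⟩ := Module.End.exists_eigenvalue (T.restrict hT)
  obtain ⟨w, hw⟩ := hμ.exists_hasEigenvector
  refine ⟨w, w.2, fun h => hw.2 (Subtype.ext h), μ, ?_⟩
  exact congrArg Subtype.val hw.apply_eq_smul

/-- This is `⟨v, S T v⟩ = ‖T v‖²`. It makes eigenvalues of `S T` non-negative reals and gives `ker
(S T) = ker T`. -/
theorem IsAdj.sum_star_mul {S T : Module.End ℂ (Fin n →₀ ℂ)} (h : IsAdj S T) (v : Fin n →₀ ℂ) :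
    ∑ i, star (v i) * S (T v) i = ((∑ j, ‖T v j‖ ^ 2 : ℝ) : ℂ) := by
  have h1 : ∀ i, S (T v) i = ∑ j, entry S i j * T v j := fun i =>
    apply_eq_sum S _ i (Finset.subset_univ _)
  have h2 : ∀ j, T v j = ∑ i, entry T j i * v i := fun j =>
    apply_eq_sum T _ j (Finset.subset_univ _)
  calc ∑ i, star (v i) * S (T v) i = ∑ i, ∑ j, star (entry T j i * v i) * T v j := by
        refine Finset.sum_congr rfl fun i _ => ?_
        rw [h1, Finset.mul_sum]
        refine Finset.sum_congr rfl fun j _ => ?_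
        rw [h i j, star_mul']
        ring
    _ = ∑ j, star (T v j) * T v j := by
        rw [Finset.sum_comm]
        refine Finset.sum_congr rfl fun j _ => ?_
        rw [← Finset.sum_mul, ← star_sum, ← h2]
    _ = _ := by
        push_cast
        refine Finset.sum_congr rfl fun j _ => ?_
        exact Complex.conj_mul' _

theorem sum_norm_sq_pos {v : Fin n →₀ ℂ} (hv : v ≠ 0) : 0 < ∑ i, ‖v i‖ ^ 2 := by
  obtain ⟨i, hi⟩ := Finsupp.ne_iff.mp hv
  exact Finset.sum_pos' (fun _ _ => by positivity)
    ⟨i, Finset.mem_univ _, by have := norm_pos_iff.mpr hi; positivity⟩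

theorem IsAdj.eigenvalue_real {S T : Module.End ℂ (Fin n →₀ ℂ)} (h : IsAdj S T)
    {v : Fin n →₀ ℂ} (hv : v ≠ 0) {μ : ℂ} (hμ : S (T v) = μ • v) :
    ∃ r : ℝ, 0 ≤ r ∧ μ = r := by
  have h1 := h.sum_star_mul v
  have h2 : ∑ i, star (v i) * S (T v) i = μ * ((∑ i, ‖v i‖ ^ 2 : ℝ) : ℂ) := by
    rw [hμ]
    push_cast
    rw [Finset.mul_sum]
    refine Finset.sum_congr rfl fun i _ => ?_
    rw [← Complex.conj_mul']
    simp only [Pi.smul_apply, smul_eq_mul, starRingEnd_apply]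
    ring
  have h3 := sum_norm_sq_pos hv
  refine ⟨(∑ j, ‖T v j‖ ^ 2) / ∑ i, ‖v i‖ ^ 2, by positivity, ?_⟩
  rw [Complex.ofReal_div, ← h1, h2, mul_div_cancel_right₀]
  exact_mod_cast h3.ne'

theorem IsAdj.eq_zero_of_apply_apply {S T : Module.End ℂ (Fin n →₀ ℂ)} (h : IsAdj S T)
    {v : Fin n →₀ ℂ} (hv : S (T v) = 0) : T v = 0 := by
  by_contra hne
  have h1 := h.sum_star_mul v
  rw [hv] at h1
  simp only [Finsupp.coe_zero, Pi.zero_apply, mul_zero, Finset.sum_const_zero] at h1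
  exact (sum_norm_sq_pos hne).ne (by exact_mod_cast h1)

namespace StarRep

/-- `p` is an eigenvalue of `φ(D)`. -/
def IsWeight (φ : StarRep L a (Fin n)) (p : ℝ) : Prop :=
  ∃ v : Fin n →₀ ℂ, v ≠ 0 ∧ φ.opW (φ.opV v) = (p : ℂ) • v

theorem IsWeight.nonneg {φ : StarRep L a (Fin n)} {p : ℝ} (h : φ.IsWeight p) : 0 ≤ p := by
  obtain ⟨v, hv, hp⟩ := h
  obtain ⟨r, hr, h⟩ := φ.isAdj_WV.eigenvalue_real hv hp
  rwa [Complex.ofReal_inj.mp h]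

theorem finite_setOf_isWeight (φ : StarRep L a (Fin n)) : {p | φ.IsWeight p}.Finite := by
  have h := Module.End.finite_spectrum (φ.opW * φ.opV)
  refine (h.preimage (Complex.ofReal_injective.injOn)).subset ?_
  rintro p ⟨v, hv, hp⟩
  exact Module.End.HasEigenvalue.mem_spectrum
    (Module.End.hasEigenvalue_of_hasEigenvector (x := v)
      ⟨Module.End.mem_eigenspace_iff.mpr hp, hv⟩)

theorem nonempty_setOf_isWeight (φ : StarRep L a (Fin n)) [Nonempty (Fin n)] :
    {p | φ.IsWeight p}.Nonempty := by
  obtain ⟨w, -, hw, μ, hμ⟩ := exists_eigenvector_mem (φ.opW * φ.opV) ⊤ (fun _ _ => trivial)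
    (v := Finsupp.single (Classical.arbitrary (Fin n)) 1) trivial (by simp)
  obtain ⟨r, -, rfl⟩ := φ.isAdj_WV.eigenvalue_real hw hμ
  exact ⟨r, w, hw, hμ⟩

/-- Every eigenvalue `p` of `φ(D)` belongs to a joint eigenvector of `φ(D)` and `φ(D̃)`, with second
eigenvalue `q`; the weights `q` and `a + (tr A) p - q` obtained by applying `W` and `V` are again
eigenvalues of `φ(D)` unless `q` and `p` vanish. -/
theorem IsWeight.exists_joint (hdet : detA L = 1) {φ : StarRep L a (Fin n)} {p : ℝ}
    (h : φ.IsWeight p) : ∃ v : Fin n →₀ ℂ, v ≠ 0 ∧ φ.opW (φ.opV v) = (p : ℂ) • v ∧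
      ∃ q : ℝ, 0 ≤ q ∧ φ.opV (φ.opW v) = (q : ℂ) • v ∧ (q ≠ 0 → φ.IsWeight q) ∧
        (p ≠ 0 → φ.IsWeight (a + trA L * p - q)) := by
  obtain ⟨v, hv, hp⟩ := h
  -- `WV` and `VW` commute: expanding `W V²` on the left and `W² V` on the right gives the same
  -- words. Hence `VW` preserves the eigenspaces of `WV`.
  have hcomm : ∀ x, φ.opW (φ.opV (φ.opV (φ.opW x))) = φ.opV (φ.opW (φ.opW (φ.opV x))) := by
    intro x
    rw [φ.rel_right hdet, φ.rel_left hdet]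
    simp only [map_add, map_sub, map_smul]
  obtain ⟨w, hw, hw0, μ, hμ⟩ := exists_eigenvector_mem (φ.opV * φ.opW)
    (LinearMap.ker (φ.opW * φ.opV - (p : ℂ) • 1)) (fun x hx => by
      rw [LinearMap.mem_ker] at hx ⊢
      have hx' : φ.opW (φ.opV x) = (p : ℂ) • x := by simpa [sub_eq_zero] using hx
      simp [hcomm, hx']) (v := v) (by simp [hp]) hv
  have hw' : φ.opW (φ.opV w) = (p : ℂ) • w := by simpa [sub_eq_zero] using hw
  change φ.opV (φ.opW w) = _ at hμ
  obtain ⟨q, hq, rfl⟩ := φ.isAdj_VW.eigenvalue_real hw0 hμ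
  refine ⟨w, hw0, hw', q, hq, hμ, fun hq0 => ⟨φ.opW w, fun h0 => ?_, ?_⟩,
    fun hp0 => ⟨φ.opV w, fun h0 => ?_, ?_⟩⟩
  · rw [h0, map_zero] at hμ
    exact smul_ne_zero (by exact_mod_cast hq0) hw0 hμ.symm
  · rw [hμ, map_smul]
  · rw [h0, map_zero] at hw'
    exact smul_ne_zero (by exact_mod_cast hp0) hw0 hw'.symm
  · rw [weight_V hdet hw' hμ]
    push_cast
    rfl

theorem IsIrreducible.dim_eq_one_of_eigenvector {φ : StarRep L a (Fin n)} (h : φ.IsIrreducible)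
    {v : Fin n →₀ ℂ} (hv : v ≠ 0) {l m : ℂ} (hW : φ.opW v = l • v) (hV : φ.opV v = m • v) :
    n = 1 := by
  have key : ∀ (T : Module.End ℂ (Fin n →₀ ℂ)) (c : ℂ), T v = c • v →
      ∀ x ∈ Submodule.span ℂ {v}, T x ∈ Submodule.span ℂ {v} := by
    intro T c hT x hx
    obtain ⟨b, rfl⟩ := Submodule.mem_span_singleton.mp hx
    rw [map_smul, hT]
    exact Submodule.smul_mem _ _ (Submodule.smul_mem _ _ (Submodule.mem_span_singleton_self v))
  rcases (φ.isIrreducible_iff.mp h).2 _ (key _ l hW) (key _ m hV) with h1 | h1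
  · exact absurd (Submodule.span_singleton_eq_bot.mp h1) hv
  · have h2 := finrank_span_singleton (K := ℂ) hv
    rw [h1, finrank_top, Module.finrank_finsupp_self, Fintype.card_fin] at h2
    exact h2

/-- When `(p, p)` is a fixed point of the weight dynamics, `W` preserves its joint eigenspace. For
`p ≠ 0` an eigenvector of `W` there has eigenvalue `μ ≠ 0`, and `V` acts on it by `p / μ`; for `p =
0` both `W` and `V` kill the vector. -/
theorem IsIrreducible.dim_eq_one_of_fixed (hdet : detA L = 1) {φ : StarRep L a (Fin n)}
    (h : φ.IsIrreducible) {v : Fin n →₀ ℂ} (hv : v ≠ 0) {p : ℂ}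
    (hp : φ.opW (φ.opV v) = p • v) (hq : φ.opV (φ.opW v) = p • v)
    (hfix : a + (trA L : ℝ) * p - p = p) : n = 1 := by
  rcases eq_or_ne p 0 with rfl | hp0
  · rw [zero_smul] at hp hq
    exact h.dim_eq_one_of_eigenvector hv (l := 0) (m := 0)
      (by rw [φ.isAdj_VW.eq_zero_of_apply_apply hq, zero_smul])
      (by rw [φ.isAdj_WV.eq_zero_of_apply_apply hp, zero_smul])
  · obtain ⟨w, ⟨hw1, hw2⟩, hw0, μ, hμ⟩ := exists_eigenvector_mem φ.opW
      (LinearMap.ker (φ.opW * φ.opV - p • 1) ⊓ LinearMap.ker (φ.opV * φ.opW - p • 1))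
      (fun x hx => by
        obtain ⟨hx1, hx2⟩ := hx
        have hx1' : φ.opW (φ.opV x) = p • x := by simpa [sub_eq_zero] using hx1
        have hx2' : φ.opV (φ.opW x) = p • x := by simpa [sub_eq_zero] using hx2
        have h3 := weight_W hdet hx1' hx2'
        rw [hfix] at h3
        exact ⟨by simp [hx2'], by simp [h3]⟩) (v := v) ⟨by simp [hp], by simp [hq]⟩ hv
    have hw2' : φ.opV (φ.opW w) = p • w := by simpa [sub_eq_zero] using hw2
    rw [hμ, map_smul] at hw2'
    have hμ0 : μ ≠ 0 := by
      rintro rfl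
      rw [zero_smul] at hw2'
      exact smul_ne_zero hp0 hw0 hw2'.symm
    refine h.dim_eq_one_of_eigenvector hw0 hμ (m := μ⁻¹ * p) ?_
    rw [mul_smul, ← hw2', inv_smul_smul₀ hμ0]

/-- Extremal argument at the largest weight `p`, with neighbours `q` and `p' = a + t p - q`. Both
are at most `p`, so `a + (t - 2) p = p' + q - 2 p ≤ 0`; the opposite inequality gives `q = p = p'`.
-/
theorem IsIrreducible.dim_eq_one (hdet : detA L = 1) {φ : StarRep L a (Fin n)} {chat : ℝ}
    (hirr : φ.IsIrreducible) (hcas : φ.HasCasimir chat) (ht : 2 ≤ trA L)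
    (ht2 : trA L = 2 → 0 < a ∨ (a = 0 ∧ 0 < chat))
    (hG : 0 ≤ chat → ∀ r, 0 ≤ r → 0 ≤ chat + 2 * a * r + (trA L - 2) * r ^ 2) : n = 1 := by
  have := hirr.1
  obtain ⟨p, hp, hmax⟩ := Set.exists_max_image _ id φ.finite_setOf_isWeight
    φ.nonempty_setOf_isWeight
  obtain ⟨m, hm, hmin⟩ := Set.exists_min_image _ id φ.finite_setOf_isWeight
    φ.nonempty_setOf_isWeight
  simp only [id, Set.mem_ofPred_eq] at hmax hmin hp hm
  obtain ⟨v, hv, hpv, q, hq, hqv, hq1, hq2⟩ := hp.exists_joint hdet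
  have hK := hcas.eq hv hpv hqv
  have hqp : q ≤ p := by
    by_cases h0 : q = 0
    · rw [h0]; exact hp.nonneg
    · exact hmax q (hq1 h0)
  suffices h : q = p ∧ (p ≠ 0 → a + trA L * p - p = p) by
    obtain ⟨rfl, h2⟩ := h
    rcases eq_or_ne q 0 with rfl | h0
    · have h1 : φ.opW v = 0 := φ.isAdj_VW.eq_zero_of_apply_apply (by simp [hqv])
      have h2 : φ.opV v = 0 := φ.isAdj_WV.eq_zero_of_apply_apply (by simp [hpv])
      exact hirr.dim_eq_one_of_eigenvector hv (l := 0) (m := 0) (by simp [h1]) (by simp [h2])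
    · exact hirr.dim_eq_one_of_fixed hdet hv hpv hqv (by exact_mod_cast h2 h0)
  rcases hp.nonneg.eq_or_lt with h0 | hpos
  · exact ⟨by linarith, fun h => absurd h0.symm h⟩
  have hp' := hmax _ (hq2 hpos.ne')
  -- The left side equals `-(p - q) * (p - p')`.
  have hprod : chat + 2 * a * p + (trA L - 2) * p ^ 2 ≤ 0 := by
    have := mul_nonneg (sub_nonneg.mpr hqp) (sub_nonneg.mpr hp')
    nlinarith
  have hconv : a + (trA L - 2) * p ≤ 0 := by linarith
  suffices h : 0 ≤ a + (trA L - 2) * p by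
    exact ⟨by linarith, fun _ => by linarith⟩
  rcases ht.eq_or_lt with h2 | h2
  · rw [← h2] at hconv hprod
    rcases ht2 h2.symm with h3 | ⟨h3, h4⟩
    · linarith
    · rw [h3] at hprod; linarith
  rcases le_or_gt 0 chat with hc | hc
  · by_contra! hneg
    set s := trA L - 2 with hs
    have hs0 : 0 < s := by linarith
    -- The point is the vertex of `G`, which lies to the right of `p` if the slope of `G` at `p` is
    -- negative; there `G` falls strictly below `G p ≤ 0`.
    have h5 := hG hc (p - (a + s * p) / s) (by
      have : (a + s * p) / s ≤ 0 := div_nonpos_of_nonpos_of_nonneg hneg.le hs0.le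
      linarith)
    have h6 : chat + 2 * a * (p - (a + s * p) / s) + s * (p - (a + s * p) / s) ^ 2
        = (chat + 2 * a * p + s * p ^ 2) - (a + s * p) ^ 2 / s := by
      field_simp
      ring
    have h7 : 0 < (a + s * p) ^ 2 / s := div_pos (by nlinarith) hs0
    linarith
  -- For `ĉ₁ < 0` the smallest weight `m` is used. As `a < 0`, a vanishing weight would make the
  -- conserved quantity non-negative, so both neighbours of `m` are genuine weights, at least `m`.
  -- Thus `a + (t - 2) m ≥ 0`, and `p ≥ m` concludes.
  · obtain ⟨v', hv', hpv', q', hq', hqv', hq1', hq2'⟩ := hm.exists_joint hdet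
    have hK' := hcas.eq hv' hpv' hqv'
    have ha : a < 0 := by nlinarith
    have hq0 : q' ≠ 0 := by
      rintro rfl
      nlinarith [hm.nonneg]
    have hm0 : m ≠ 0 := by
      rintro rfl
      nlinarith
    have h8 := hmin _ (hq1' hq0)
    have h9 := hmin _ (hq2' hm0)
    have h10 := hmin _ hp
    nlinarith

end StarRep

end

section

variable {L : AffPlane} {a : ℝ} {ι : Type*}

/-! ### Weighted shifts -/

/-- The operator `e_i ↦ u_i e_{f(i)}`. -/
def shiftOp (f : ι → ι) (u : ι → ℝ) : Module.End ℂ (ι →₀ ℂ) :=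
  Finsupp.linearCombination ℂ fun i => Finsupp.single (f i) (u i : ℂ)

theorem shiftOp_single (f : ι → ι) (u : ι → ℝ) (i : ι) :
    shiftOp f u (Finsupp.single i 1) = (u i : ℂ) • Finsupp.single (f i) 1 := by
  simp [shiftOp]

theorem end_ext_single {S T : Module.End ℂ (ι →₀ ℂ)}
    (h : ∀ i, S (Finsupp.single i 1) = T (Finsupp.single i 1)) : S = T :=
  Finsupp.lhom_ext' fun i => LinearMap.ext_ring (h i)

/-- A pair of weighted shifts `W e_i = u_i e_{f(i)}`, `V e_i = v_i e_{g(i)}` that are adjoint to each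
other and satisfy the relations of `C_{L,a}` with `tr A = t` and `det A = 1`, with weights `p_i` and
`q_i` of `WV` and `VW`. -/
structure ShiftPair (a t : ℝ) (ι : Type*) where
  f : ι → ι
  g : ι → ι
  u : ι → ℝ
  v : ι → ℝ
  p : ι → ℝ
  q : ι → ℝ
  adj : ∀ i j, (Finsupp.single (g j) (v j) i : ℝ) = Finsupp.single (f i) (u i) j
  mul_p : ∀ i, v i * u (g i) = p i
  mul_q : ∀ i, u i * v (f i) = q i
  fg : ∀ i, p i ≠ 0 → f (g i) = i
  gf : ∀ i, q i ≠ 0 → g (f i) = i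
  step_u : ∀ i, u i ≠ 0 → p i = a - q (f i) + t * q i
  step_v : ∀ i, v i ≠ 0 → p (g i) = a - q i + t * p i

namespace ShiftPair

variable {t : ℝ}

/-- Exchange of the two shifts. -/
def swap (s : ShiftPair a t ι) : ShiftPair a t ι where
  f := s.g
  g := s.f
  u := s.v
  v := s.u
  p := s.q
  q := s.p
  adj i j := (s.adj j i).symm
  mul_p := s.mul_q
  mul_q := s.mul_p
  fg := s.gf
  gf := s.fg
  step_u i h := by linarith [s.step_v i h]
  step_v i h := by linarith [s.step_u i h]

theorem apply_p (s : ShiftPair a t ι) (i : ι) :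
    shiftOp s.f s.u (shiftOp s.g s.v (Finsupp.single i 1)) = (s.p i : ℂ) • Finsupp.single i 1 := by
  rw [shiftOp_single, map_smul, shiftOp_single, smul_smul, ← Complex.ofReal_mul, s.mul_p]
  rcases eq_or_ne (s.p i) 0 with h | h
  · simp [h]
  · rw [s.fg i h]

theorem apply_q (s : ShiftPair a t ι) (i : ι) :
    shiftOp s.g s.v (shiftOp s.f s.u (Finsupp.single i 1)) = (s.q i : ℂ) • Finsupp.single i 1 :=
  s.swap.apply_p i

theorem relation (s : ShiftPair a t ι) :
    shiftOp s.f s.u * shiftOp s.f s.u * shiftOp s.g s.v = (a : ℂ) • shiftOp s.f s.u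
      - ((1 : ℝ) : ℂ) • (shiftOp s.g s.v * shiftOp s.f s.u * shiftOp s.f s.u)
      + (t : ℂ) • (shiftOp s.f s.u * shiftOp s.g s.v * shiftOp s.f s.u) := by
  refine end_ext_single fun i => ?_
  simp only [Module.End.mul_apply, LinearMap.add_apply, LinearMap.sub_apply, LinearMap.smul_apply]
  rw [s.apply_p, s.apply_q, map_smul, map_smul, shiftOp_single s.f s.u i, map_smul, map_smul,
    s.apply_q (s.f i)]
  simp only [smul_smul, ← add_smul, ← sub_smul]
  congr 1
  rcases eq_or_ne (s.u i) 0 with h | h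
  · simp [h]
  · rw [s.step_u i h]
    push_cast
    ring

/-- The representation by a pair of weighted shifts. -/
def rep (s : ShiftPair a (trA L) ι) (hdet : detA L = 1) : StarRep L a ι :=
  StarRep.ofAdj (CAlg.lift (fun | .W => shiftOp s.f s.u | .V => shiftOp s.g s.v)
      (by rw [hdet]; exact s.relation)
      (by
        have h := s.swap.relation
        simp only [swap] at h
        -- The relation of the exchanged pair has the two outer words interchanged; with coefficient
        -- `det A = 1` it can be solved for the other one.
        have h2 : ∀ x y z w : Module.End ℂ (ι →₀ ℂ), x = y - ((1 : ℝ) : ℂ) • z + w →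
            z = y - ((1 : ℝ) : ℂ) • x + w := by
          rintro x y z w rfl
          simp only [Complex.ofReal_one, one_smul]
          abel
        rw [hdet]
        exact h2 _ _ _ _ h))
    (fun i j => by
      rw [CAlg.lift_gen, CAlg.lift_gen]
      have h := s.adj i j
      classical
      simp only [Finsupp.single_apply] at h
      simp only [entry, shiftOp_single, Finsupp.coe_smul, Pi.smul_apply, smul_eq_mul,
        Finsupp.single_apply]
      split_ifs at h ⊢ <;> first | (simp [h]; done) | simp [h.symm])

variable (s : ShiftPair a (trA L) ι) (hdet : detA L = 1)

theorem rep_opW : (s.rep hdet).opW = shiftOp s.f s.u := CAlg.lift_gen _ _ _ _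

theorem rep_opV : (s.rep hdet).opV = shiftOp s.g s.v := CAlg.lift_gen _ _ _ _

theorem rep_W_ne_zero_iff (i j : ι) : (s.rep hdet).W i j ≠ 0 ↔ s.f j = i ∧ s.u j ≠ 0 := by
  classical
  rw [StarRep.W_eq, rep_opW]
  simp [entry, shiftOp_single, Finsupp.single_apply]

theorem rep_hasCasimir {chat : ℝ}
    (h : ∀ i, s.p i ^ 2 + s.q i ^ 2 - trA L * s.p i * s.q i - a * (s.p i + s.q i) = chat) :
    (s.rep hdet).HasCasimir chat := by
  refine end_ext_single fun i => ?_
  rw [StarRep.casimir_apply (p := s.p i) (q := s.q i) _ (by rw [rep_opW, rep_opV, s.apply_p])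
    (by rw [rep_opW, rep_opV, s.apply_q]), ← h i, LinearMap.smul_apply, Module.End.one_apply]
  push_cast
  rfl

end ShiftPair

/-- A non-zero subspace invariant under a diagonal matrix with distinct entries contains a basis
vector. -/
theorem exists_single_mem_of_diagonal {T : Module.End ℂ (ι →₀ ℂ)} {ν : ι → ℂ}
    (hν : Function.Injective ν) (hT : ∀ i, T (Finsupp.single i 1) = ν i • Finsupp.single i 1)
    {S : Submodule ℂ (ι →₀ ℂ)} (hS : ∀ v ∈ S, T v ∈ S) (hne : S ≠ ⊥) :
    ∃ i, Finsupp.single i 1 ∈ S := by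
  classical
  have happ : ∀ v i, T v i = ν i * v i := by
    intro v i
    rw [apply_eq_sum T v i (s := insert i v.support) (Finset.subset_insert _ _),
      Finset.sum_eq_single i]
    · simp [entry, hT]
    · intro j _ hj
      simp [entry, hT, hj]
    · simp
  suffices h : ∀ (m : ℕ) (v), v ∈ S → v ≠ 0 → v.support.card ≤ m →
      ∃ i, Finsupp.single i 1 ∈ S by
    obtain ⟨v, hv, hv0⟩ := S.ne_bot_iff.mp hne
    exact h _ v hv hv0 le_rfl
  intro m
  induction m with
  | zero =>
    intro v _ hv0 hcard
    exact absurd (Finsupp.card_support_eq_zero.mp (Nat.le_zero.mp hcard)) hv0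
  | succ m ih =>
    intro v hv hv0 hcard
    obtain ⟨i, hi⟩ := Finsupp.support_nonempty_iff.mpr hv0
    -- `T - ν i` erases the coordinate `i` and creates none, so either the support shrinks or `v` is
    -- a multiple of one basis vector.
    set w := T v - ν i • v with hw
    have hwj : ∀ j, w j = (ν j - ν i) * v j := fun j => by
      simp [hw, happ, sub_mul]
    have hwS : w ∈ S := S.sub_mem (hS v hv) (S.smul_mem _ hv)
    by_cases hw0 : w = 0
    · refine ⟨i, ?_⟩
      have h1 : v = Finsupp.single i (v i) := by
        ext j
        rcases eq_or_ne j i with rfl | hj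
        · simp
        · have h2 := hwj j
          rw [hw0, Finsupp.coe_zero, Pi.zero_apply, eq_comm, mul_eq_zero, sub_eq_zero] at h2
          rw [Finsupp.single_eq_of_ne hj]
          exact h2.resolve_left fun h => hj (hν h)
      have h3 : Finsupp.single i (1 : ℂ) = (v i)⁻¹ • v := by
        conv_rhs => rw [h1]
        simp [inv_mul_cancel₀ (Finsupp.mem_support_iff.mp hi)]
      rw [h3]
      exact S.smul_mem _ hv
    · refine ih w hwS hw0 ?_
      have h1 : w.support ⊆ v.support.erase i := by
        intro j hj
        rw [Finsupp.mem_support_iff, hwj] at hj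
        refine Finset.mem_erase.mpr ⟨?_, Finsupp.mem_support_iff.mpr (right_ne_zero_of_mul hj)⟩
        rintro rfl
        simp at hj
      have h2 := Finset.card_le_card h1
      rw [Finset.card_erase_of_mem hi] at h2
      omega

theorem eq_top_of_single_mem {S : Submodule ℂ (ι →₀ ℂ)} (h : ∀ i, Finsupp.single i 1 ∈ S) :
    S = ⊤ := by
  refine eq_top_iff.mpr fun v _ => ?_
  rw [← Finsupp.sum_single v]
  refine S.sum_mem fun i _ => ?_
  have h1 := S.smul_mem (v i) (h i)
  rwa [Finsupp.smul_single_one] at h1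

/-- Some combination of `WV` and `VW` is diagonal with distinct entries, so an invariant subspace
contains a basis vector, and connectedness of the graph of non-zero weights then yields all of them.
-/
theorem ShiftPair.rep_isIrreducible [Nonempty ι] (s : ShiftPair a (trA L) ι) (hdet : detA L = 1)
    (x y : ℝ) (hinj : Function.Injective fun i => x * s.p i + y * s.q i)
    (hconn : ∀ Q : ι → Prop, (∀ i, Q i → s.u i ≠ 0 → Q (s.f i)) →
      (∀ i, Q i → s.v i ≠ 0 → Q (s.g i)) → ∀ i j, Q i → Q j) :
    (s.rep hdet).IsIrreducible := by
  rw [StarRep.isIrreducible_iff]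
  refine ⟨inferInstance, fun S hW hV => or_iff_not_imp_left.mpr fun hne => ?_⟩
  rw [rep_opW] at hW
  rw [rep_opV] at hV
  obtain ⟨i, hi⟩ := exists_single_mem_of_diagonal
    (T := (x : ℂ) • (shiftOp s.f s.u * shiftOp s.g s.v)
      + (y : ℂ) • (shiftOp s.g s.v * shiftOp s.f s.u))
    (ν := fun i => ((x * s.p i + y * s.q i : ℝ) : ℂ)) (Complex.ofReal_injective.comp hinj)
    (fun i => by
      simp only [LinearMap.add_apply, LinearMap.smul_apply, Module.End.mul_apply, s.apply_p,
        s.apply_q, smul_smul, ← add_smul]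
      push_cast
      rfl)
    (fun v hv => S.add_mem (S.smul_mem _ (hW _ (hV _ hv))) (S.smul_mem _ (hV _ (hW _ hv)))) hne
  have key : ∀ (f : ι → ι) (u : ι → ℝ), (∀ v ∈ S, shiftOp f u v ∈ S) →
      ∀ i, Finsupp.single i (1 : ℂ) ∈ S → u i ≠ 0 → Finsupp.single (f i) (1 : ℂ) ∈ S := by
    intro f u h i hi hu
    have h1 := S.smul_mem ((u i : ℂ)⁻¹) (h _ hi)
    rwa [shiftOp_single, inv_smul_smul₀ (by exact_mod_cast hu)] at h1
  exact eq_top_of_single_mem fun j =>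
    hconn (fun i => Finsupp.single i (1 : ℂ) ∈ S) (key _ _ hW) (key _ _ hV) i j hi

/-! ### Weights labelled by the natural numbers -/

/-- The pair of shifts with weights `e` on the half-line: `W` lowers. -/
def ShiftPair.ofNat {t : ℝ} (e : ℕ → ℝ) (h0 : e 0 = 0) (hpos : ∀ n, 0 < e (n + 1))
    (hrec : ∀ n, e (n + 2) = a + t * e (n + 1) - e n) : ShiftPair a t ℕ where
  -- Truncation at `i = 0` is harmless, because the coefficient `√(e 0)` vanishes.
  f i := i - 1
  g i := i + 1
  u i := √(e i)
  v i := √(e (i + 1))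
  p i := e (i + 1)
  q i := e i
  adj i j := by
    simp only [Finsupp.single_apply]
    rcases i with _ | i
    · simp [h0]
    · by_cases h : i = j
      · simp [h]
      · simp [h, Ne.symm h]
  mul_p i := Real.mul_self_sqrt (hpos i).le
  mul_q i := by
    rcases i with _ | i
    · simp [h0]
    · exact Real.mul_self_sqrt (hpos i).le
  fg i _ := by simp
  gf i h := by
    rcases i with _ | i
    · exact absurd h0 h
    · simp
  step_u i h := by
    rcases i with _ | i
    · simp [h0] at h
    · have := hrec i
      simp only [Nat.add_sub_cancel]
      linarith
  step_v i _ := by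
    have := hrec i
    linarith

section nat

variable (e : ℕ → ℝ) (h0 : e 0 = 0) (hpos : ∀ n, 0 < e (n + 1))
    (hrec : ∀ n, e (n + 2) = a + trA L * e (n + 1) - e n) (hdet : detA L = 1)

theorem ofNat_isOneSided : ((ShiftPair.ofNat e h0 hpos hrec).rep hdet).IsOneSided := by
  refine Or.inl fun i j => ?_
  rw [ShiftPair.rep_W_ne_zero_iff]
  simp only [ShiftPair.ofNat]
  rcases j with _ | j
  · simp [h0]
  · simp [(Real.sqrt_pos.mpr (hpos j)).ne', eq_comm]

theorem ofNat_swap_isOneSided : ((ShiftPair.ofNat e h0 hpos hrec).swap.rep hdet).IsOneSided := by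
  refine Or.inr fun i j => ?_
  rw [ShiftPair.rep_W_ne_zero_iff]
  simp [ShiftPair.ofNat, ShiftPair.swap, (Real.sqrt_pos.mpr (hpos j)).ne', eq_comm]

theorem casimir_seq {t chat : ℝ} (h0 : e 0 = 0) (hrec : ∀ n, e (n + 2) = a + t * e (n + 1) - e n)
    (h1 : e 1 ^ 2 - a * e 1 = chat) (n : ℕ) :
    e (n + 1) ^ 2 + e n ^ 2 - t * e (n + 1) * e n - a * (e (n + 1) + e n) = chat := by
  induction n with
  | zero => rw [h0, ← h1]; ring
  | succ n ih => rw [hrec, ← ih]; ring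

theorem ofNat_hasCasimir {chat : ℝ} (h1 : e 1 ^ 2 - a * e 1 = chat) :
    ((ShiftPair.ofNat e h0 hpos hrec).rep hdet).HasCasimir chat :=
  ShiftPair.rep_hasCasimir _ _ (casimir_seq e h0 hrec h1)

theorem ofNat_swap_hasCasimir {chat : ℝ} (h1 : e 1 ^ 2 - a * e 1 = chat) :
    ((ShiftPair.ofNat e h0 hpos hrec).swap.rep hdet).HasCasimir chat :=
  ShiftPair.rep_hasCasimir _ _ fun i => by
    have := casimir_seq e h0 hrec h1 i
    simp only [ShiftPair.ofNat, ShiftPair.swap]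
    linarith

theorem nat_connected {Q : ℕ → Prop} (hdown : ∀ i, Q (i + 1) → Q i) (hup : ∀ i, Q i → Q (i + 1))
    (i j : ℕ) (hi : Q i) : Q j := by
  have h : Q 0 := by
    induction i with
    | zero => exact hi
    | succ i ih => exact ih (hdown i hi)
  induction j with
  | zero => exact h
  | succ j ih => exact hup j ih

theorem ofNat_isIrreducible (hmono : StrictMono e) :
    ((ShiftPair.ofNat e h0 hpos hrec).rep hdet).IsIrreducible := by
  refine ShiftPair.rep_isIrreducible _ _ 0 1 (fun i j h => hmono.injective (by simpa [ShiftPair.ofNat, ShiftPair.swap] using h)) ?_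
  intro Q hf hg
  exact nat_connected (fun i h => hf (i + 1) h (Real.sqrt_pos.mpr (hpos i)).ne')
    (fun i h => hg i h (Real.sqrt_pos.mpr (hpos i)).ne')

theorem ofNat_swap_isIrreducible (hmono : StrictMono e) :
    ((ShiftPair.ofNat e h0 hpos hrec).swap.rep hdet).IsIrreducible := by
  refine ShiftPair.rep_isIrreducible _ _ 1 0 (fun i j h => hmono.injective (by simpa [ShiftPair.ofNat, ShiftPair.swap] using h)) ?_
  intro Q hf hg
  exact nat_connected (fun i h => hg (i + 1) h (Real.sqrt_pos.mpr (hpos i)).ne')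
    (fun i h => hf i h (Real.sqrt_pos.mpr (hpos i)).ne')

/-- `W` kills a basis vector in the first representation and is injective in the second. -/
theorem ofNat_not_equivalent_swap : ¬ ((ShiftPair.ofNat e h0 hpos hrec).rep hdet).Equivalent
    ((ShiftPair.ofNat e h0 hpos hrec).swap.rep hdet) := by
  rintro ⟨U, hU⟩
  have h1 := hU (CAlg.gen L a .W) (Finsupp.single 0 1)
  change U (StarRep.opW _ _) = StarRep.opW _ _ at h1
  rw [ShiftPair.rep_opW, ShiftPair.rep_opW, shiftOp_single] at h1
  simp only [ShiftPair.ofNat, ShiftPair.swap, h0, Real.sqrt_zero, Complex.ofReal_zero, zero_smul,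
    map_zero] at h1
  have hker : ∀ w : ℕ →₀ ℂ, shiftOp (fun i : ℕ => i + 1) (fun i => √(e (i + 1))) w = 0 → w = 0 := by
    intro w hw
    ext i
    have h2 := DFunLike.congr_fun hw (i + 1)
    rw [apply_eq_sum _ w (i + 1) (s := insert i w.support) (Finset.subset_insert _ _),
      Finset.sum_eq_single i] at h2
    · simpa [entry, shiftOp_single, (Real.sqrt_pos.mpr (hpos i)).ne'] using h2
    · intro j _ hj
      simp [entry, shiftOp_single, hj]
    · simp
  have h3 := hker _ h1.symm
  rw [U.map_eq_zero_iff] at h3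
  simp at h3

end nat

/-! ### Weights labelled by the integers -/

/-- The pair of shifts with weights `e` on the line: `W` lowers. -/
def ShiftPair.ofInt {t : ℝ} (e : ℤ → ℝ) (hpos : ∀ n, 0 < e n)
    (hrec : ∀ n, e (n + 1) = a + t * e n - e (n - 1)) : ShiftPair a t ℤ where
  f i := i - 1
  g i := i + 1
  u i := √(e i)
  v i := √(e (i + 1))
  p i := e (i + 1)
  q i := e i
  adj i j := by
    simp only [Finsupp.single_apply]
    by_cases h : j + 1 = i
    · simp [← h]
    · rw [if_neg h, if_neg (by omega)]
  mul_p i := Real.mul_self_sqrt (hpos _).le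
  mul_q i := by simpa using Real.mul_self_sqrt (hpos i).le
  fg i _ := by simp
  gf i h := by simp
  step_u i h := by linarith [hrec i]
  step_v i _ := by
    have := hrec (i + 1)
    rw [add_sub_cancel_right] at this
    linarith

section int

variable (e : ℤ → ℝ) (hpos : ∀ n, 0 < e n) (hdet : detA L = 1)
    (hrec : ∀ n, e (n + 1) = a + trA L * e n - e (n - 1))

theorem ofInt_isTwoSided : ((ShiftPair.ofInt e hpos hrec).rep hdet).IsTwoSided := by
  intro i j
  rw [ShiftPair.rep_W_ne_zero_iff]
  simp only [ShiftPair.ofInt, ne_eq, (Real.sqrt_pos.mpr (hpos j)).ne', not_false_eq_true, and_true]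
  omega

theorem ofInt_isIrreducible (hconv : ∀ n, 0 < a + (trA L - 2) * e n) :
    ((ShiftPair.ofInt e hpos hrec).rep hdet).IsIrreducible := by
  -- The sequence itself takes each value twice when it is symmetric; its increments `p - q` are
  -- separated by strict convexity.
  refine ShiftPair.rep_isIrreducible _ _ 1 (-1) (StrictMono.injective ?_) ?_
  · refine strictMono_int_of_lt_succ fun n => ?_
    have h1 := hconv (n + 1)
    have h2 := hrec (n + 1)
    rw [add_sub_cancel_right] at h2
    simp only [ShiftPair.ofInt]
    linarith
  · intro Q hf hg i j hi
    simp only [ShiftPair.ofInt, ne_eq, (Real.sqrt_pos.mpr (hpos _)).ne', not_false_eq_true,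
      forall_const] at hf hg
    exact Int.inductionOn' (motive := Q) j i hi (fun k _ h => hg k h) (fun k _ h => hf k h)

end int

end

section

variable {L : AffPlane} {a t chat : ℝ} {ι : Type*}

/-! ### Existence of weighted shifts -/

/-- The sequence with `e_{n+2} = a + t e_{n+1} - e_n`. -/
def affSeq (a t x y : ℝ) : ℕ → ℝ
  | 0 => x
  | 1 => y
  | n + 2 => a + t * affSeq a t x y (n + 1) - affSeq a t x y n

theorem exists_oneSided (hdet : detA L = 1) {d : ℝ} (hd : 0 < d) (hroot : d ^ 2 - a * d = chat)
    -- Left abstract because growth has two sources: positivity of `G`, or `a > 0` together with `t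
    -- ≥ 2`.
    (hstep : ∀ x y, 0 ≤ x → x < y → y ^ 2 + x ^ 2 - trA L * y * x - a * (y + x) = chat →
      y < a + trA L * y - x) :
    ∃ φ ψ : StarRep L a ℕ,
        (φ.HasCasimir chat ∧ φ.IsOneSided ∧ φ.IsIrreducible) ∧
        (ψ.HasCasimir chat ∧ ψ.IsOneSided ∧ ψ.IsIrreducible) ∧
        ¬ φ.Equivalent ψ := by
  set e := affSeq a (trA L) 0 d with he
  have h0 : e 0 = 0 := rfl
  have hrec : ∀ n, e (n + 2) = a + trA L * e (n + 1) - e n := fun n => rfl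
  have hcas := casimir_seq e h0 hrec hroot
  have hinc : ∀ n, 0 ≤ e n ∧ e n < e (n + 1) := by
    intro n
    induction n with
    | zero => exact ⟨le_rfl, hd⟩
    | succ n ih =>
      refine ⟨ih.1.trans ih.2.le, ?_⟩
      rw [hrec]
      exact hstep _ _ ih.1 ih.2 (hcas n)
  have hpos : ∀ n, 0 < e (n + 1) := fun n => (hinc n).1.trans_lt (hinc n).2
  have hmono : StrictMono e := strictMono_nat_of_lt_succ fun n => (hinc n).2
  exact ⟨(ShiftPair.ofNat e h0 hpos hrec).rep hdet, (ShiftPair.ofNat e h0 hpos hrec).swap.rep hdet,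
    ⟨ofNat_hasCasimir e h0 hpos hrec hdet hroot, ofNat_isOneSided e h0 hpos hrec hdet,
      ofNat_isIrreducible e h0 hpos hrec hdet hmono⟩,
    ⟨ofNat_swap_hasCasimir e h0 hpos hrec hdet hroot, ofNat_swap_isOneSided e h0 hpos hrec hdet,
      ofNat_swap_isIrreducible e h0 hpos hrec hdet hmono⟩,
    ofNat_not_equivalent_swap e h0 hpos hrec hdet⟩

theorem exists_twoSided (hdet : detA L = 1) (ht : 2 ≤ trA L) {r : ℝ} (hr : 0 < r)
    (hroot : chat + 2 * a * r + (trA L - 2) * r ^ 2 = 0) (hconv : 0 < a + (trA L - 2) * r) :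
    ∃ φ : StarRep L a ℤ, φ.HasCasimir chat ∧ φ.IsTwoSided ∧ φ.IsIrreducible := by
  set s := affSeq a (trA L) r (a + trA L * r - r) with hs
  have hinc : ∀ n, r ≤ s n ∧ s n ≤ s (n + 1) := by
    intro n
    induction n with
    | zero => exact ⟨le_rfl, by change r ≤ a + trA L * r - r; linarith⟩
    | succ n ih =>
      refine ⟨ih.1.trans ih.2, ?_⟩
      change s (n + 1) ≤ a + trA L * s (n + 1) - s n
      have : (trA L - 2) * r ≤ (trA L - 2) * s (n + 1) :=
        mul_le_mul_of_nonneg_left (ih.1.trans ih.2) (by linarith)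
      linarith [ih.2]
  -- Reflection `e (-1 - n) = e n`, so `e (-1) = e 0 = r`; this double value is compatible with the
  -- conserved quantity precisely because `G r = 0`.
  let e : ℤ → ℝ := fun i => match i with
    | Int.ofNat n => s n
    | Int.negSucc n => s n
  have hle : ∀ i, r ≤ e i := by
    rintro (n | n) <;> exact (hinc n).1
  have hrec : ∀ i, e (i + 1) = a + trA L * e i - e (i - 1) := by
    rintro ((_ | n) | (_ | n))
    · rfl
    · rw [show Int.ofNat (n + 1) - 1 = Int.ofNat n by simp]
      rfl
    · change r = a + trA L * r - (a + trA L * r - r)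
      ring
    · change s n = a + trA L * s (n + 1) - (a + trA L * s (n + 1) - s n)
      ring
  have hcas : ∀ i, e (i + 1) ^ 2 + e i ^ 2 - trA L * e (i + 1) * e i - a * (e (i + 1) + e i)
      = chat := by
    intro i
    refine Int.inductionOn' i (-1) ?_ (fun k _ h => ?_) (fun k _ h => ?_)
    · change r ^ 2 + r ^ 2 - trA L * r * r - a * (r + r) = chat
      linarith
    · have := hrec (k + 1)
      rw [add_sub_cancel_right] at this
      rw [this, ← h]
      ring
    · have h1 : e (k - 1) = a + trA L * e k - e (k + 1) := by linarith [hrec k]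
      rw [sub_add_cancel, h1, ← h]
      ring
  have hpos : ∀ i, 0 < e i := fun i => hr.trans_le (hle i)
  refine ⟨(ShiftPair.ofInt e hpos hrec).rep hdet, ShiftPair.rep_hasCasimir _ _ hcas,
    ofInt_isTwoSided e hpos hdet hrec, ofInt_isIrreducible e hpos hdet hrec fun i => ?_⟩
  have : (trA L - 2) * r ≤ (trA L - 2) * e i := mul_le_mul_of_nonneg_left (hle i) (by linarith)
  linarith

/-! ### Constraints on one-sided and two-sided representations -/

theorem apply_single_eq {T : Module.End ℂ (ι →₀ ℂ)} {i k : ι} (h : ∀ j, entry T j i ≠ 0 → j = k) :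
    T (Finsupp.single i 1) = entry T k i • Finsupp.single k 1 := by
  classical
  ext j
  rcases eq_or_ne j k with rfl | hj
  · simp [entry]
  · have : entry T j i = 0 := by
      by_contra h0
      exact hj (h j h0)
    simpa [hj, entry] using this

namespace StarRep

variable {φ : StarRep L a ι} {i k : ι}

theorem opW_single (h : ∀ j, φ.W j k ≠ 0 → j = i) :
    φ.opW (Finsupp.single k 1) = φ.W i k • Finsupp.single i 1 :=
  apply_single_eq h

theorem opV_single (h : ∀ j, φ.W i j ≠ 0 → j = k) :
    φ.opV (Finsupp.single i 1) = star (φ.W i k) • Finsupp.single k 1 := by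
  rw [apply_single_eq (k := k), φ.isAdj_VW, W_eq]
  intro j hj
  rw [φ.isAdj_VW, star_ne_zero] at hj
  exact h j hj

theorem opW_opV_single (h : ∀ j, φ.W i j ≠ 0 → j = k) (h' : ∀ j, φ.W j k ≠ 0 → j = i) :
    φ.opW (φ.opV (Finsupp.single i 1)) = ((‖φ.W i k‖ ^ 2 : ℝ) : ℂ) • Finsupp.single i 1 := by
  rw [opV_single h, map_smul, opW_single h', smul_smul]
  congr 1
  push_cast
  exact Complex.conj_mul' _

theorem opV_opW_single (h : ∀ j, φ.W i j ≠ 0 → j = k) (h' : ∀ j, φ.W j k ≠ 0 → j = i) :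
    φ.opV (φ.opW (Finsupp.single k 1)) = ((‖φ.W i k‖ ^ 2 : ℝ) : ℂ) • Finsupp.single k 1 := by
  rw [opW_single h', map_smul, opV_single h, smul_smul]
  congr 1
  push_cast
  exact Complex.mul_conj' _

/-- At the end vector one of the weights `p`, `q` is zero, and the conserved quantity reduces to `d²
- a d` in the other. -/
theorem IsOneSided.exists_root {φ : StarRep L a ℕ} (h : φ.IsOneSided) (hc : φ.HasCasimir chat) :
    ∃ d, 0 < d ∧ d ^ 2 - a * d = chat := by
  have hne : (Finsupp.single 0 1 : ℕ →₀ ℂ) ≠ 0 := by simp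
  rcases h with h | h
  · have hp := opW_opV_single (φ := φ) (i := 0) (k := 1) (fun j hj => (h 0 j).mp hj)
      (fun j hj => by have := (h j 1).mp hj; omega)
    have hq : φ.opV (φ.opW (Finsupp.single 0 1)) = ((0 : ℝ) : ℂ) • Finsupp.single 0 1 := by
      have h0 : φ.W 0 0 = 0 := by
        by_contra h0
        have := (h 0 0).mp h0
        omega
      rw [opW_single (i := 0) fun j hj => by have := (h j 0).mp hj; omega, h0]
      simp
    have h1 := norm_pos_iff.mpr ((h 0 1).mpr rfl)
    refine ⟨‖φ.W 0 1‖ ^ 2, by positivity, ?_⟩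
    rw [← hc.eq hne hp hq]
    ring
  · have hq := opV_opW_single (φ := φ) (i := 1) (k := 0)
      (fun j hj => by have := (h 1 j).mp hj; omega) (fun j hj => (h j 0).mp hj)
    have hp : φ.opW (φ.opV (Finsupp.single 0 1)) = ((0 : ℝ) : ℂ) • Finsupp.single 0 1 := by
      have h0 : φ.W 0 0 = 0 := by
        by_contra h0
        have := (h 0 0).mp h0
        omega
      rw [opV_single (k := 0) fun j hj => by have := (h 0 j).mp hj; omega, h0]
      simp
    have h1 := norm_pos_iff.mpr ((h 1 0).mpr rfl)
    refine ⟨‖φ.W 1 0‖ ^ 2, by positivity, ?_⟩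
    rw [← hc.eq hne hp hq]
    ring

theorem IsTwoSided.exists_seq {φ : StarRep L a ℤ} (hdet : detA L = 1) (h : φ.IsTwoSided)
    (hc : φ.HasCasimir chat) : ∃ d : ℤ → ℝ, (∀ i, 0 < d i) ∧
      (∀ i, d (i + 1) = a + trA L * d i - d (i - 1)) ∧
      ∀ i, d (i + 1) ^ 2 + d i ^ 2 - trA L * d (i + 1) * d i - a * (d (i + 1) + d i) = chat := by
  have hne : ∀ i : ℤ, (Finsupp.single i 1 : ℤ →₀ ℂ) ≠ 0 := by simp
  have hq : ∀ i, φ.opV (φ.opW (Finsupp.single i 1))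
      = ((‖φ.W (i - 1) i‖ ^ 2 : ℝ) : ℂ) • Finsupp.single i 1 := fun i =>
    opV_opW_single (fun j hj => by have := (h _ j).mp hj; omega)
      (fun j hj => by have := (h j i).mp hj; omega)
  have hp : ∀ i, φ.opW (φ.opV (Finsupp.single i 1))
      = ((‖φ.W i (i + 1)‖ ^ 2 : ℝ) : ℂ) • Finsupp.single i 1 := fun i =>
    opW_opV_single (fun j hj => (h _ j).mp hj)
      (fun j hj => by have := (h j _).mp hj; omega)
  refine ⟨fun i => ‖φ.W (i - 1) i‖ ^ 2, fun i => ?_, fun i => ?_, fun i => ?_⟩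
  · have h1 := norm_pos_iff.mpr ((h (i - 1) i).mpr (by omega))
    positivity
  · have h1 := weight_W hdet (hp i) (hq i)
    have hw := opW_single (φ := φ) (i := i - 1) (k := i)
      (fun j hj => by have := (h j i).mp hj; omega)
    have hw0 : φ.W (i - 1) i ≠ 0 := (h _ _).mpr (by omega)
    have h2 := hq (i - 1)
    rw [hw, map_smul, map_smul, h2, smul_comm] at h1
    have h3 := smul_left_injective ℂ (smul_ne_zero hw0 (hne (i - 1))) h1
    norm_cast at h3
    simp only [add_sub_cancel_right]
    linarith
  · simpa only [add_sub_cancel_right] using hc.eq (hne i) (hp i) (hq i)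

end StarRep

/-- Links algebra and geometry: the product of successive increments is `G` at the middle term. -/
theorem mul_diff_eq {x y : ℝ} (h : y ^ 2 + x ^ 2 - t * y * x - a * (y + x) = chat) :
    (a + t * y - x - y) * (y - x) = chat + 2 * a * y + (t - 2) * y ^ 2 := by
  rw [← h]
  ring

/-- To the left of `0` the terms stay in the compact interval `[0, d 0]`, where `G` has a minimum `m
> 0`. Two consecutive increments with product at least `m` have sum at least `√m`, so the sequence
decreases linearly to the left and leaves the positive axis. -/
theorem no_increasing_seq (hG : ∀ r, 0 ≤ r → 0 < chat + 2 * a * r + (t - 2) * r ^ 2) {d : ℤ → ℝ}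
    (hpos : ∀ i, 0 < d i) (hmono : StrictMono d)
    (hG' : ∀ i, (d (i + 1) - d i) * (d i - d (i - 1))
      = chat + 2 * a * d i + (t - 2) * d i ^ 2) : False := by
  obtain ⟨x, hx, hmin⟩ := (isCompact_Icc (a := (0 : ℝ)) (b := d 0)).exists_isMinOn
    ⟨0, le_rfl, (hpos 0).le⟩
    (f := fun r => chat + 2 * a * r + (t - 2) * r ^ 2) (by fun_prop)
  set m := chat + 2 * a * x + (t - 2) * x ^ 2 with hm
  have hm0 : 0 < m := hG x hx.1
  have hstep : ∀ i ≤ 0, d (i - 1) ≤ d (i + 1) - √m := by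
    intro i hi
    have h1 : m ≤ _ := hmin (show d i ∈ Set.Icc 0 (d 0) from ⟨(hpos i).le, hmono.monotone hi⟩)
    simp only [← hG' i] at h1
    have h2 : 0 < d (i + 1) - d i := sub_pos.mpr (hmono (by omega))
    have h3 : 0 < d i - d (i - 1) := sub_pos.mpr (hmono (by omega))
    have h4 : √m ≤ d (i + 1) - d (i - 1) := by
      refine Real.sqrt_le_iff.mpr ⟨by linarith, ?_⟩
      nlinarith
    linarith
  have hn : ∀ n : ℕ, d (-(2 * n)) ≤ d 0 - n * √m := by
    intro n
    induction n with
    | zero => simp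
    | succ n ih =>
      have h1 := hstep (-(2 * n) - 1) (by omega)
      rw [sub_add_cancel, show (-(2 * (n : ℤ)) - 1 - 1) = -(2 * ((n + 1 : ℕ) : ℤ)) by
        push_cast; ring] at h1
      push_cast at h1 ⊢
      linarith
  obtain ⟨n, hn'⟩ := exists_nat_gt (d 0 / √m)
  rw [div_lt_iff₀ (Real.sqrt_pos.mpr hm0)] at hn'
  linarith [hn n, hpos (-(2 * n))]

theorem no_positive_seq (hG : ∀ r, 0 ≤ r → 0 < chat + 2 * a * r + (t - 2) * r ^ 2) {d : ℤ → ℝ}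
    (hpos : ∀ i, 0 < d i) (hrec : ∀ i, d (i + 1) = a + t * d i - d (i - 1))
    (hcas : ∀ i, d (i + 1) ^ 2 + d i ^ 2 - t * d (i + 1) * d i - a * (d (i + 1) + d i) = chat) :
    False := by
  have hG' : ∀ i, (d (i + 1) - d i) * (d i - d (i - 1))
      = chat + 2 * a * d i + (t - 2) * d i ^ 2 := by
    intro i
    have h := hcas (i - 1)
    rw [sub_add_cancel] at h
    rw [hrec i]
    exact mul_diff_eq h
  have hprod : ∀ i, 0 < (d (i + 1) - d i) * (d i - d (i - 1)) := fun i => by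
    rw [hG']
    exact hG _ (hpos i).le
  rcases lt_or_ge 0 (d (0 + 1) - d 0) with h0 | h0
  · refine no_increasing_seq hG hpos (strictMono_int_of_lt_succ fun i => sub_pos.mp ?_) hG'
    refine Int.inductionOn' (motive := fun i => 0 < d (i + 1) - d i) i 0 h0 (fun k _ h => ?_)
      (fun k _ h => ?_)
    · have := hprod (k + 1)
      rw [add_sub_cancel_right] at this
      exact pos_of_mul_pos_left this h.le
    · rw [sub_add_cancel]
      exact pos_of_mul_pos_right (hprod k) h.le
  · have hneg : ∀ i, d (i + 1) - d i < 0 := by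
      intro i
      refine Int.inductionOn' (motive := fun i => d (i + 1) - d i < 0) i 0
        (lt_of_le_of_ne h0 (left_ne_zero_of_mul (hprod 0).ne')) (fun k _ h => ?_) (fun k _ h => ?_)
      · have := hprod (k + 1)
        rw [add_sub_cancel_right] at this
        exact neg_of_mul_pos_left this h.le
      · rw [sub_add_cancel]
        exact neg_of_mul_pos_right (hprod k) h.le
    -- The identity for increments is invariant under `i ↦ -i`, so a decreasing sequence may be
    -- reversed.
    refine no_increasing_seq (d := fun i => d (-i)) hG (fun i => hpos _)
      (strictMono_int_of_lt_succ fun i => ?_) fun i => ?_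
    · have := hneg (-(i + 1))
      rw [neg_add, neg_add_cancel_right] at this
      rw [neg_add]
      linarith
    · have := hG' (-i)
      rw [show -(i + 1) = -i - 1 by ring, show -(i - 1) = -i + 1 by ring, ← this]
      ring

end

section

variable {α₀ α₁ c₀ : ℝ}

/-! ### Geometry of the surface -/

/-- The function `g` for which the surface is `z² = g(x² + y²)`. -/
def profile (α₀ α₁ c₀ r : ℝ) : ℝ := c₀ - α₀ * r - α₁ / 2 * r ^ 2

theorem continuous_profile : Continuous (profile α₀ α₁ c₀) := by
  unfold profile
  fun_prop

theorem mem_surface_iff {p : ℝ × ℝ × ℝ} : p ∈ surface α₀ α₁ c₀ ↔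
    p.2.2 ^ 2 = profile α₀ α₁ c₀ (p.1 ^ 2 + p.2.1 ^ 2) := by
  simp only [surface, poly, profile, Set.mem_ofPred_eq]
  constructor <;> intro h <;> linarith

theorem isClosed_surface : IsClosed (surface α₀ α₁ c₀) :=
  isClosed_eq (by unfold poly; fun_prop) continuous_const

theorem isClosed_connectedComponentIn {X : Type*} [TopologicalSpace X] {F : Set X}
    (hF : IsClosed F) (x : X) : IsClosed (connectedComponentIn F x) := by
  by_cases hx : x ∈ F
  · rw [connectedComponentIn_eq_image hx]
    exact hF.isClosedEmbedding_subtypeVal.isClosedMap _ isClosed_connectedComponent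
  · rw [connectedComponentIn_eq_empty hx]
    exact isClosed_empty

/-- When no component of the surface is compact, the set of squared radii it attains is closed
upwards. -/
theorem profile_nonneg_of_le
    (hnc : ∀ p ∈ surface α₀ α₁ c₀, ¬ IsCompact (connectedComponentIn (surface α₀ α₁ c₀) p))
    {s R : ℝ} (hs : 0 ≤ s) (hgs : 0 ≤ profile α₀ α₁ c₀ s) (hsR : s ≤ R) :
    0 ≤ profile α₀ α₁ c₀ R := by
  by_contra! hneg
  have hp : ((√s, 0, √(profile α₀ α₁ c₀ s)) : ℝ × ℝ × ℝ) ∈ surface α₀ α₁ c₀ := by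
    rw [mem_surface_iff]
    simp [Real.sq_sqrt hs, Real.sq_sqrt hgs]
  set p : ℝ × ℝ × ℝ := (√s, 0, √(profile α₀ α₁ c₀ s)) with hpdef
  refine hnc p hp ?_
  set C := connectedComponentIn (surface α₀ α₁ c₀) p with hC
  -- A connected set reaching beyond squared radius `R` would meet it, but no point of the surface
  -- lies there since `profile R < 0`. The component is therefore bounded.
  have hrad : ∀ q ∈ C, q.1 ^ 2 + q.2.1 ^ 2 ≤ R := by
    intro q hq
    by_contra! hlt
    have himg := (isPreconnected_connectedComponentIn (x := p)
      (F := surface α₀ α₁ c₀)).intermediate_value (mem_connectedComponentIn hp) hq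
      (f := fun q => q.1 ^ 2 + q.2.1 ^ 2) (by fun_prop)
    have hpr : p.1 ^ 2 + p.2.1 ^ 2 = s := by simp [hpdef, Real.sq_sqrt hs]
    obtain ⟨w, hw, hwR⟩ := himg (show R ∈ Set.Icc _ _ from ⟨by simpa [hpr] using hsR, hlt.le⟩)
    have h1 := mem_surface_iff.mp (connectedComponentIn_subset _ _ hw)
    simp only at hwR
    rw [hwR] at h1
    linarith [sq_nonneg w.2.2]
  obtain ⟨M, hM⟩ := (isCompact_Icc (a := (0 : ℝ)) (b := R)).bddAbove_image
    (continuous_profile (α₀ := α₀) (α₁ := α₁) (c₀ := c₀)).continuousOn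
  have hM' : ∀ q ∈ C, q.2.2 ^ 2 ≤ M := by
    intro q hq
    rw [mem_surface_iff.mp (connectedComponentIn_subset _ _ hq)]
    exact hM ⟨_, ⟨by positivity, hrad q hq⟩, rfl⟩
  refine Metric.isCompact_of_isClosed_isBounded
    (isClosed_connectedComponentIn isClosed_surface p) ?_
  refine (Metric.isBounded_Icc (-√R, -√R, -√M) (√R, √R, √M)).subset fun q hq => ?_
  have h1 := Real.abs_le_sqrt (show q.1 ^ 2 ≤ R by nlinarith [hrad q hq, sq_nonneg q.2.1])
  have h2 := Real.abs_le_sqrt (show q.2.1 ^ 2 ≤ R by nlinarith [hrad q hq, sq_nonneg q.1])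
  have h3 := Real.abs_le_sqrt (hM' q hq)
  rw [abs_le] at h1 h2 h3
  exact ⟨⟨h1.1, h2.1, h3.1⟩, ⟨h1.2, h2.2, h3.2⟩⟩

theorem exists_profile_nonneg (hne : (surface α₀ α₁ c₀).Nonempty) :
    ∃ s, 0 ≤ s ∧ 0 ≤ profile α₀ α₁ c₀ s := by
  obtain ⟨p, hp⟩ := hne
  exact ⟨p.1 ^ 2 + p.2.1 ^ 2, by positivity, by rw [← mem_surface_iff.mp hp]; positivity⟩

theorem leading_coeff_nonpos (hne : (surface α₀ α₁ c₀).Nonempty)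
    (hnc : ∀ p ∈ surface α₀ α₁ c₀, ¬ IsCompact (connectedComponentIn (surface α₀ α₁ c₀) p)) :
    α₁ ≤ 0 := by
  by_contra! h
  obtain ⟨s, hs, hgs⟩ := exists_profile_nonneg hne
  -- Large enough for the quadratic term to dominate beyond it.
  set B := 2 * (|c₀| + |α₀|) / α₁ with hB
  have hB0 : 0 ≤ B := by positivity
  have hαB : α₁ * B = 2 * (|c₀| + |α₀|) := by rw [hB]; field_simp
  have h1 := profile_nonneg_of_le hnc hs hgs (R := s + 1 + B) (by linarith)
  unfold profile at h1
  set R := s + 1 + B with hR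
  have hR1 : 1 ≤ R := by linarith
  have h2 : |c₀| + |α₀| < α₁ / 2 * R := by nlinarith
  have h3 : (|c₀| + |α₀|) * R < α₁ / 2 * R * R := mul_lt_mul_of_pos_right h2 (by linarith)
  have h4 : |c₀| ≤ |c₀| * R := le_mul_of_one_le_right (abs_nonneg _) hR1
  have h5 : -α₀ * R ≤ |α₀| * R := mul_le_mul_of_nonneg_right (neg_le_abs _) (by linarith)
  nlinarith [le_abs_self c₀]

theorem linear_coeff_of_leading_coeff_eq_zero (hparam : α₀ ≠ 0 ∨ α₁ ≠ 0 ∨ c₀ ≠ 0)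
    (hne : (surface α₀ α₁ c₀).Nonempty)
    (hnc : ∀ p ∈ surface α₀ α₁ c₀, ¬ IsCompact (connectedComponentIn (surface α₀ α₁ c₀) p))
    (h0 : α₁ = 0) : α₀ < 0 ∨ (α₀ = 0 ∧ 0 < c₀) := by
  obtain ⟨s, hs, hgs⟩ := exists_profile_nonneg hne
  rcases lt_trichotomy α₀ 0 with h | h | h
  · exact Or.inl h
  · refine Or.inr ⟨h, ?_⟩
    simp only [profile, h, h0] at hgs
    have hc : c₀ ≠ 0 := by simpa [h, h0] using hparam
    exact lt_of_le_of_ne (by linarith) hc.symm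
  · exfalso
    have h1 := profile_nonneg_of_le hnc hs hgs (R := s + 1 + |c₀| / α₀) (by
      have : 0 ≤ |c₀| / α₀ := by positivity
      linarith)
    have h2 : α₀ * (|c₀| / α₀) = |c₀| := by field_simp
    simp only [profile, h0] at h1
    nlinarith [le_abs_self c₀]

/-- If the profile vanishes somewhere, the two halves of the surface meet, so that the surface is
connected. -/
theorem isPreconnected_surface
    (hnc : ∀ p ∈ surface α₀ α₁ c₀, ¬ IsCompact (connectedComponentIn (surface α₀ α₁ c₀) p))
    {r : ℝ} (hr : 0 ≤ r) (hgr : profile α₀ α₁ c₀ r = 0) : IsPreconnected (surface α₀ α₁ c₀) := by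
  set I := {r | 0 ≤ r ∧ 0 ≤ profile α₀ α₁ c₀ r} with hI
  have hIc : IsPreconnected I := by
    refine Set.OrdConnected.isPreconnected ⟨fun x hx y _ z hz => ?_⟩
    exact ⟨hx.1.trans hz.1, profile_nonneg_of_le hnc hx.1 hx.2 hz.1⟩
  let F : ℝ → ℝ × ℝ → ℝ × ℝ × ℝ := fun σ w =>
    (√w.1 * Real.cos w.2, √w.1 * Real.sin w.2, σ * √(profile α₀ α₁ c₀ w.1))
  have hF : ∀ σ, IsPreconnected (F σ '' (I ×ˢ Set.univ)) := fun σ =>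
    (hIc.prod isPreconnected_univ).image _ (by
      have := continuous_profile (α₀ := α₀) (α₁ := α₁) (c₀ := c₀)
      fun_prop)
  have hunion : surface α₀ α₁ c₀ = F 1 '' (I ×ˢ Set.univ) ∪ F (-1) '' (I ×ˢ Set.univ) := by
    apply Set.Subset.antisymm
    · intro p hp
      obtain ⟨x, y, z⟩ := p
      rw [mem_surface_iff] at hp
      simp only at hp
      have hx : √(x ^ 2 + y ^ 2) * Real.cos (Complex.arg ⟨x, y⟩) = x := by
        have h := Complex.norm_mul_cos_arg ⟨x, y⟩
        rwa [Complex.norm_def, Complex.normSq_mk, ← pow_two, ← pow_two] at h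
      have hy : √(x ^ 2 + y ^ 2) * Real.sin (Complex.arg ⟨x, y⟩) = y := by
        have h := Complex.norm_mul_sin_arg ⟨x, y⟩
        rwa [Complex.norm_def, Complex.normSq_mk, ← pow_two, ← pow_two] at h
      have hmem : x ^ 2 + y ^ 2 ∈ I := ⟨by positivity, by rw [← hp]; positivity⟩
      rcases le_total 0 z with hz | hz
      · refine Or.inl ⟨(x ^ 2 + y ^ 2, Complex.arg ⟨x, y⟩), ⟨hmem, trivial⟩, ?_⟩
        simp only [F, hx, hy, ← hp, Real.sqrt_sq hz, one_mul]
      · refine Or.inr ⟨(x ^ 2 + y ^ 2, Complex.arg ⟨x, y⟩), ⟨hmem, trivial⟩, ?_⟩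
        simp only [F, hx, hy, ← hp, Real.sqrt_sq_eq_abs, abs_of_nonpos hz]
        simp
    · rintro p (⟨⟨s, θ⟩, ⟨⟨hs, hgs⟩, -⟩, rfl⟩ | ⟨⟨s, θ⟩, ⟨⟨hs, hgs⟩, -⟩, rfl⟩)
      all_goals
        simp only at hs hgs
        have h1 : (√s * Real.cos θ) ^ 2 + (√s * Real.sin θ) ^ 2 = s := by
          rw [mul_pow, mul_pow, Real.sq_sqrt hs, ← mul_add, Real.cos_sq_add_sin_sq, mul_one]
        rw [mem_surface_iff]
        simp only [F, h1]
        rw [mul_pow, Real.sq_sqrt hgs]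
        norm_num
  rw [hunion]
  have hmem : (r, (0 : ℝ)) ∈ I ×ˢ (Set.univ : Set ℝ) := ⟨⟨hr, hgr.ge⟩, trivial⟩
  exact IsPreconnected.union (F 1 (r, 0)) ⟨_, hmem, rfl⟩ ⟨_, hmem, by simp [F, hgr]⟩ (hF 1) (hF _)

theorem profile_pos_of_card_eq_two
    (hnc : ∀ p ∈ surface α₀ α₁ c₀, ¬ IsCompact (connectedComponentIn (surface α₀ α₁ c₀) p))
    (hcard : Nat.card (ConnectedComponents (surface α₀ α₁ c₀)) = 2) {r : ℝ} (hr : 0 ≤ r) :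
    0 < profile α₀ α₁ c₀ r := by
  have hzero : ∀ s, 0 ≤ s → profile α₀ α₁ c₀ s ≠ 0 := by
    intro s hs h
    have := isPreconnected_iff_preconnectedSpace.mp (isPreconnected_surface hnc hs h)
    have h1 := Finite.card_le_one_iff_subsingleton
      (α := ConnectedComponents (surface α₀ α₁ c₀))|>.mpr inferInstance
    omega
  have hne : (surface α₀ α₁ c₀).Nonempty := by
    by_contra h
    have : IsEmpty (surface α₀ α₁ c₀) := Set.isEmpty_coe_sort.mpr (Set.not_nonempty_iff_eq_empty.mp h)
    have : IsEmpty (ConnectedComponents (surface α₀ α₁ c₀)) :=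
      ⟨fun x => by
        obtain ⟨y, -⟩ := ConnectedComponents.surjective_coe x
        exact isEmptyElim y⟩
    simp at hcard
  obtain ⟨s, hs, hgs⟩ := exists_profile_nonneg hne
  by_contra! hneg
  have hrs : r ≤ s := by
    by_contra! hlt
    exact hzero r hr (le_antisymm hneg (profile_nonneg_of_le hnc hs hgs hlt.le))
  obtain ⟨x, hx, hx0⟩ := intermediate_value_Icc hrs
    (continuous_profile (α₀ := α₀) (α₁ := α₁) (c₀ := c₀)).continuousOn ⟨hneg, hgs⟩
  exact hzero x (hr.trans hx.1) hx0

theorem fderiv_poly_eq_zero {x y : ℝ} (h : x ^ 2 + y ^ 2 = 0 ∨ α₀ + α₁ * (x ^ 2 + y ^ 2) = 0) :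
    fderiv ℝ (poly α₀ α₁ c₀) (x, y, 0) = 0 := by
  let p : ℝ × ℝ × ℝ := (x, y, 0)
  have hsq : ∀ f : ℝ × ℝ × ℝ → ℝ, Differentiable ℝ f → f p = 0 →
      HasFDerivAt (fun q => f q ^ 2) (0 : ℝ × ℝ × ℝ →L[ℝ] ℝ) p := by
    intro f hf h0
    have h1 := (hf p).hasFDerivAt.pow 2
    simpa [h0] using h1
  have hz := hsq (fun q => q.2.2) (by fun_prop) rfl
  have hρ : ∃ D : ℝ × ℝ × ℝ →L[ℝ] ℝ, HasFDerivAt (fun q : ℝ × ℝ × ℝ => q.1 ^ 2 + q.2.1 ^ 2) D p ∧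
      (-α₀ - α₁ * (x ^ 2 + y ^ 2)) • D = 0 := by
    rcases h with h | h
    · have hx : x = 0 := by nlinarith [sq_nonneg x, sq_nonneg y]
      have hy : y = 0 := by nlinarith [sq_nonneg x, sq_nonneg y]
      exact ⟨0 + 0, (hsq (fun q => q.1) (by fun_prop) hx).add
        (hsq (fun q => q.2.1) (by fun_prop) hy), by simp⟩
    · refine ⟨_, (show DifferentiableAt ℝ _ p by fun_prop).hasFDerivAt, ?_⟩
      rw [show -α₀ - α₁ * (x ^ 2 + y ^ 2) = 0 by linarith, zero_smul]
  obtain ⟨D, hD, hD0⟩ := hρ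
  have hg : HasDerivAt (profile α₀ α₁ c₀) (-α₀ - α₁ * (x ^ 2 + y ^ 2)) (x ^ 2 + y ^ 2) := by
    unfold profile
    have h1 := (((hasDerivAt_id (x ^ 2 + y ^ 2)).const_mul α₀).const_sub c₀).sub
      (((hasDerivAt_id (x ^ 2 + y ^ 2)).pow 2).const_mul (α₁ / 2))
    exact h1.congr_deriv (by simp; ring)
  have h2 := hg.comp_hasFDerivAt p hD
  rw [hD0] at h2
  have h3 := (hz.const_mul (1 / 2 : ℝ)).sub (h2.const_mul (1 / 2 : ℝ))
  -- With `C = (z² - profile (x² + y²)) / 2`, the first term is critical at `z = 0`, the second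
  -- where `x² + y²` or `profile` is.
  have h4 : poly α₀ α₁ c₀ = fun q => 1 / 2 * q.2.2 ^ 2 - 1 / 2 *
      (profile α₀ α₁ c₀ ∘ fun q : ℝ × ℝ × ℝ => q.1 ^ 2 + q.2.1 ^ 2) q := by
    funext q
    simp only [poly, profile, Function.comp]
    ring
  rw [h4]
  exact h3.fderiv.trans (by simp)

/-- A connected non-singular surface without compact components has a throat: a positive simple
root of the profile. -/
theorem exists_throat (hconn : IsConnected (surface α₀ α₁ c₀)) (hns : Nonsingular α₀ α₁ c₀)
    (hnc : ∀ p ∈ surface α₀ α₁ c₀, ¬ IsCompact (connectedComponentIn (surface α₀ α₁ c₀) p)) :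
    c₀ < 0 ∧ ∃ r, 0 < r ∧ profile α₀ α₁ c₀ r = 0 ∧ 0 < -α₀ - α₁ * r := by
  -- The reflection `z ↦ -z` preserves the surface, so connectedness forces a point with `z = 0`.
  -- Non-singularity makes its squared radius positive and a simple root.
  obtain ⟨x, y, hxy⟩ : ∃ x y : ℝ, ((x, y, 0) : ℝ × ℝ × ℝ) ∈ surface α₀ α₁ c₀ := by
    obtain ⟨⟨x, y, z⟩, hp⟩ := hconn.nonempty
    have hp' : ((x, y, -z) : ℝ × ℝ × ℝ) ∈ surface α₀ α₁ c₀ := by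
      rw [mem_surface_iff] at hp ⊢
      simpa using hp
    have hiv : ∀ {p q : ℝ × ℝ × ℝ}, p ∈ surface α₀ α₁ c₀ → q ∈ surface α₀ α₁ c₀ →
        p.2.2 ≤ 0 → 0 ≤ q.2.2 → ∃ x y : ℝ, ((x, y, 0) : ℝ × ℝ × ℝ) ∈ surface α₀ α₁ c₀ := by
      intro p q hp hq h1 h2
      obtain ⟨⟨x, y, z⟩, hw, hz⟩ := hconn.isPreconnected.intermediate_value hp hq
        (f := fun q => q.2.2) (by fun_prop) ⟨h1, h2⟩
      simp only at hz
      exact ⟨x, y, hz ▸ hw⟩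
    rcases le_total 0 z with hz | hz
    · exact hiv hp' hp (by simpa using hz) hz
    · exact hiv hp hp' hz (by simpa using hz)
  have hD := hns _ hxy
  have hroot := mem_surface_iff.mp hxy
  simp only at hroot
  set r := x ^ 2 + y ^ 2 with hr
  have hr0 : 0 ≤ r := by positivity
  have h1 : r ≠ 0 := fun h => hD (fderiv_poly_eq_zero (Or.inl h))
  have h2 : α₀ + α₁ * r ≠ 0 := fun h => hD (fderiv_poly_eq_zero (Or.inr h))
  have hrpos : 0 < r := lt_of_le_of_ne hr0 h1.symm
  have hroot' : profile α₀ α₁ c₀ r = 0 := by rw [← hroot]; norm_num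
  set D := -α₀ - α₁ * r with hDdef
  have hexp : ∀ w, profile α₀ α₁ c₀ (r + w) = w * (D - α₁ / 2 * w) := by
    intro w
    have : profile α₀ α₁ c₀ (r + w) = profile α₀ α₁ c₀ r + w * (D - α₁ / 2 * w) := by
      simp only [profile, hDdef]
      ring
    rw [this, hroot', zero_add]
  have hα : α₁ ≤ 0 := leading_coeff_nonpos hconn.nonempty hnc
  have hD0 : D ≠ 0 := fun h => h2 (by linarith)
  -- A negative slope would make `profile` negative just to the right of its root. The denominator
  -- `1 - α₁ ≥ 1` gives a small enough displacement, also when `α₁ = 0`.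
  have hDpos : 0 < D := by
    by_contra! hneg
    have hneg' : D < 0 := lt_of_le_of_ne hneg hD0
    have hw : 0 < -D / (1 - α₁) := div_pos (by linarith) (by linarith)
    have h3 := profile_nonneg_of_le hnc hr0 hroot'.ge (R := r + -D / (1 - α₁)) (by linarith)
    rw [hexp] at h3
    have h4 := nonneg_of_mul_nonneg_right h3 hw
    have h5 : (1 - α₁) * (-D / (1 - α₁)) = -D := mul_div_cancel₀ _ (by linarith)
    nlinarith
  refine ⟨?_, r, hrpos, hroot', hDpos⟩
  -- If `profile 0 = c₀ ≥ 0`, upward closure would make `profile` non-negative just to the left of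
  -- `r`, against the positive slope.
  by_contra! hc
  set w := min r (D / (1 - α₁)) with hw
  have hw0 : 0 < w := lt_min hrpos (div_pos hDpos (by linarith))
  have h3 := profile_nonneg_of_le hnc le_rfl (by simpa [profile] using hc) (R := r + -w)
    (by linarith [min_le_left r (D / (1 - α₁))])
  rw [hexp] at h3
  have h4 : (1 - α₁) * w ≤ D := by
    have := min_le_right r (D / (1 - α₁))
    rw [← hw, le_div_iff₀ (by linarith)] at this
    linarith
  have h5 : 0 < D - α₁ / 2 * -w := by nlinarith
  nlinarith [mul_pos hw0 h5]

end

/-! ### Quadratic equation at the end vector and the throat condition -/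

theorem quadratic_root {a x : ℝ} (h : 0 ≤ a ^ 2 + 4 * x) :
    ((a + √(a ^ 2 + 4 * x)) / 2) ^ 2 - a * ((a + √(a ^ 2 + 4 * x)) / 2) = x := by
  linear_combination (1 / 4) * Real.sq_sqrt h

theorem quadratic_ne_of_neg {a x d : ℝ} (hx : x < 0) (h : a ≤ 0 ∨ a ^ 2 + 4 * x < 0)
    (hd : 0 < d) : d ^ 2 - a * d ≠ x := by
  intro hroot
  rcases h with h | h
  · linarith [mul_nonneg hd.le (neg_nonneg.mpr h), sq_nonneg d]
  · nlinarith [sq_nonneg (2 * d - a)]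

theorem throat_condition_iff {α₀ α₁ c₀ h : ℝ} (hα : α₁ < 0) :
    α₀ ^ 2 / α₁ ^ 2 + 2 * c₀ / α₁ ≤ (-α₀ / α₁) ^ 2 * (1 + -(α₁ * h / 2) / 4) ↔
      0 ≤ α₀ ^ 2 * h / 8 + 2 * c₀ := by
  have h1 : (-α₀ / α₁) ^ 2 * (1 + -(α₁ * h / 2) / 4) - (α₀ ^ 2 / α₁ ^ 2 + 2 * c₀ / α₁)
      = (α₀ ^ 2 * h / 8 + 2 * c₀) / -α₁ := by
    have := hα.ne
    field_simp
    ring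
  rw [← sub_nonneg, h1, le_div_iff₀ (by linarith), zero_mul]

end NCSurface

end

/-! ### Translation between the surface and the algebra -/

theorem mainTheorem1
    -- the surface, the ordering parameters and Planck's constant
    (α₀ α₁ c₀ β' γ' δ' ħ : ℝ)
    (hsum : β' + γ' + δ' = α₁)
    (hħ : 0 < ħ) (hsmall : 0 < 1 + 2 * ħ ^ 2 * δ')
    -- the corresponding algebra
    (L : NCSurface.AffPlane) (a : ℝ)
    (ha : a = -(2 * α₀ * ħ ^ 2) / (1 + 2 * ħ ^ 2 * δ'))
    (hdet : NCSurface.detA L = (1 + 2 * ħ ^ 2 * β') / (1 + 2 * ħ ^ 2 * δ'))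
    (htr : NCSurface.trA L = (2 - 2 * ħ ^ 2 * γ') / (1 + 2 * ħ ^ 2 * δ'))
    (hdet_one : NCSurface.detA L = 1)
    -- the value of the central element, determined by `c₀`
    (chat₁ : ℝ) (hchat : c₀ = (1 + 2 * ħ ^ 2 * δ') / (4 * ħ ^ 2) * chat₁)
    -- the parameters of the surface that enter the throat condition when `α₁ ≠ 0`
    (Δ μ c : ℝ)
    (hΔ : Δ = 1 + NCSurface.detA L - NCSurface.trA L)
    (hμ : μ = -α₀ / α₁) (hc : c = α₀ ^ 2 / α₁ ^ 2 + 2 * c₀ / α₁)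
    (hparam : α₀ ≠ 0 ∨ α₁ ≠ 0 ∨ c₀ ≠ 0)
    (hne : (NCSurface.surface α₀ α₁ c₀).Nonempty)
    (hnoncompact : ∀ p ∈ NCSurface.surface α₀ α₁ c₀,
      ¬ IsCompact (connectedComponentIn (NCSurface.surface α₀ α₁ c₀) p)) :
    -- 1. finite-dimensional irreducible representations
    (∀ (n : ℕ) (φ : NCSurface.StarRep L a (Fin n)),
      φ.HasCasimir chat₁ → φ.IsIrreducible → n = 1) ∧
    -- 2. two components
    (Nat.card (ConnectedComponents (NCSurface.surface α₀ α₁ c₀)) = 2 →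
      (∃ φ ψ : NCSurface.StarRep L a ℕ,
        (φ.HasCasimir chat₁ ∧ φ.IsOneSided ∧ φ.IsIrreducible) ∧
        (ψ.HasCasimir chat₁ ∧ ψ.IsOneSided ∧ ψ.IsIrreducible) ∧
        ¬ φ.Equivalent ψ) ∧
      ¬ ∃ φ : NCSurface.StarRep L a ℤ, φ.HasCasimir chat₁ ∧ φ.IsTwoSided) ∧
    -- 3. connected and non-singular
    (IsConnected (NCSurface.surface α₀ α₁ c₀) → NCSurface.Nonsingular α₀ α₁ c₀ →
      (∃ φ : NCSurface.StarRep L a ℤ,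
        φ.HasCasimir chat₁ ∧ φ.IsTwoSided ∧ φ.IsIrreducible) ∧
      ((a ≤ 0 ∨ (0 < a ∧ ((α₁ ≠ 0 ∧ c > μ ^ 2 * (1 + |Δ| / 4)) ∨
            (α₁ = 0 ∧ a ^ 2 + 4 * chat₁ < 0)))) →
        ¬ ∃ φ : NCSurface.StarRep L a ℕ, φ.HasCasimir chat₁ ∧ φ.IsOneSided) ∧
      ((0 < a ∧ ((α₁ ≠ 0 ∧ c ≤ μ ^ 2 * (1 + |Δ| / 4)) ∨
            (α₁ = 0 ∧ 0 ≤ a ^ 2 + 4 * chat₁))) →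
        ∃ φ : NCSurface.StarRep L a ℕ,
          φ.HasCasimir chat₁ ∧ φ.IsOneSided ∧ φ.IsIrreducible)) := by
  set k := 1 + 2 * ħ ^ 2 * δ' with hk
  set h := 4 * ħ ^ 2 / k with hh
  have hħ2 : ħ ≠ 0 := hħ.ne'
  have hh0 : 0 < h := by positivity
  have ha' : a = -(α₀ * h / 2) := by
    rw [ha, hh]
    field_simp
    ring
  have hchat' : chat₁ = h * c₀ := by
    rw [hchat, hh]
    field_simp
  -- `det A = 1` means that `β'` and `δ'` contribute equally, so the numerator collects to a
  -- multiple of `β' + γ' + δ' = α₁`.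
  have hΔ' : 2 - NCSurface.trA L = α₁ * h / 2 := by
    rw [hdet, div_eq_one_iff_eq hsmall.ne'] at hdet_one
    have hk2 : 2 * k = 2 + 2 * ħ ^ 2 * β' + 2 * ħ ^ 2 * δ' := by linarith
    rw [htr, hh, ← hsum]
    field_simp
    linarith
  have hΔ2 : Δ = α₁ * h / 2 := by
    rw [hΔ, hdet_one]
    linarith
  have ht : NCSurface.trA L = 2 - α₁ * h / 2 := by linarith
  have hG : ∀ r, chat₁ + 2 * a * r + (NCSurface.trA L - 2) * r ^ 2
      = h * NCSurface.profile α₀ α₁ c₀ r := by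
    intro r
    rw [hchat', ha', ht, NCSurface.profile]
    ring
  have hα : α₁ ≤ 0 := NCSurface.leading_coeff_nonpos hne hnoncompact
  have ht2 : 2 ≤ NCSurface.trA L := by
    rw [ht]
    nlinarith
  refine ⟨fun n φ hc hirr => hirr.dim_eq_one hdet_one hc ht2 (fun h2 => ?_) (fun hc0 r hr => ?_),
    fun hcard => ?_, fun hconn hns => ?_⟩
  · have h0 : α₁ = 0 := by
      rw [ht] at h2
      have : α₁ * h = 0 := by linarith
      exact (mul_eq_zero.mp this).resolve_right hh0.ne'
    rcases NCSurface.linear_coeff_of_leading_coeff_eq_zero hparam hne hnoncompact h0 with h1 | ⟨h1, h3⟩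
    · left
      rw [ha']
      nlinarith
    · right
      rw [ha', hchat', h1]
      exact ⟨by ring, by positivity⟩
  · rw [hG]
    have hc0' : 0 ≤ c₀ := by
      rw [hchat'] at hc0
      exact nonneg_of_mul_nonneg_right hc0 hh0
    exact mul_nonneg hh0.le (NCSurface.profile_nonneg_of_le hnoncompact le_rfl
      (by simpa [NCSurface.profile] using hc0') hr)
  · have hGpos : ∀ r, 0 ≤ r → 0 < chat₁ + 2 * a * r + (NCSurface.trA L - 2) * r ^ 2 := by
      intro r hr
      rw [hG]
      exact mul_pos hh0 (NCSurface.profile_pos_of_card_eq_two hnoncompact hcard hr)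
    have hc0 : 0 < chat₁ := by simpa using hGpos 0 le_rfl
    refine ⟨?_, ?_⟩
    · have hlt : |a| < √(a ^ 2 + 4 * chat₁) := Real.lt_sqrt_of_sq_lt (by rw [sq_abs]; linarith)
      refine NCSurface.exists_oneSided hdet_one (d := (a + √(a ^ 2 + 4 * chat₁)) / 2)
        (by linarith [neg_abs_le a]) (NCSurface.quadratic_root (by positivity))
        fun x y hx hxy hK => ?_
      have h1 := hGpos y (hx.trans hxy.le)
      rw [← NCSurface.mul_diff_eq hK] at h1
      linarith [pos_of_mul_pos_left h1 (sub_pos.mpr hxy).le]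
    · rintro ⟨φ, hc, hφ⟩
      obtain ⟨d, hd, hrec, hcas⟩ := hφ.exists_seq hdet_one hc
      exact NCSurface.no_positive_seq hGpos hd hrec hcas
  · obtain ⟨hc0, r, hr, hroot, hder⟩ := NCSurface.exists_throat hconn hns hnoncompact
    have hc0' : chat₁ < 0 := by
      rw [hchat']
      exact mul_neg_of_pos_of_neg hh0 hc0
    have hdisc : α₁ ≠ 0 → (c ≤ μ ^ 2 * (1 + |Δ| / 4) ↔ 0 ≤ a ^ 2 + 4 * chat₁) := by
      intro h1
      have hα' : α₁ < 0 := lt_of_le_of_ne hα h1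
      have habs : |Δ| = -(α₁ * h / 2) := by
        rw [hΔ2, abs_of_nonpos]
        nlinarith
      rw [hc, hμ, habs, NCSurface.throat_condition_iff hα']
      have h2 : a ^ 2 + 4 * chat₁ = 2 * h * (α₀ ^ 2 * h / 8 + 2 * c₀) := by
        rw [ha', hchat']
        ring
      rw [h2, mul_nonneg_iff_of_pos_left (by positivity)]
    refine ⟨NCSurface.exists_twoSided hdet_one ht2 hr (by rw [hG, hroot, mul_zero]) ?_,
      fun hcond => ?_, fun hcond => ?_⟩
    · have : a + (NCSurface.trA L - 2) * r = h / 2 * (-α₀ - α₁ * r) := by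
        rw [ha', ht]
        ring
      rw [this]
      positivity
    · rintro ⟨φ, hcas, hφ⟩
      obtain ⟨d, hd, hdroot⟩ := hφ.exists_root hcas
      have hneg : a ≤ 0 ∨ a ^ 2 + 4 * chat₁ < 0 := by
        rcases hcond with h1 | ⟨-, ⟨h1, h2⟩ | ⟨-, h2⟩⟩
        · exact Or.inl h1
        · exact Or.inr (not_le.mp fun h3 => not_le.mpr h2 ((hdisc h1).mpr h3))
        · exact Or.inr h2
      exact NCSurface.quadratic_ne_of_neg hc0' hneg hd hdroot
    · obtain ⟨ha0, hcond⟩ := hcond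
      have hpos : 0 ≤ a ^ 2 + 4 * chat₁ := by
        rcases hcond with ⟨h1, h2⟩ | ⟨-, h2⟩
        · exact (hdisc h1).mp h2
        · exact h2
      have hs0 := Real.sqrt_nonneg (a ^ 2 + 4 * chat₁)
      obtain ⟨φ, -, hφ, -⟩ := NCSurface.exists_oneSided hdet_one (chat := chat₁)
        (d := (a + √(a ^ 2 + 4 * chat₁)) / 2) (by linarith) (NCSurface.quadratic_root hpos)
        fun x y hx hxy _ => by
          have := mul_nonneg (sub_nonneg.mpr ht2) (hx.trans hxy.le)
          linarith
      exact ⟨φ, hφ⟩
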